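/- **Setting.** Structures are pairs $(H,d_N)$ with $H$ a (complete) real Hilbert space and $d_N\colon H\to[0,1]$, viewed as structures of continuous logic whose sorts are the balls $B_m(H)$ of radius $m$; the language $L_N$ has the Hilbert space operations, the inner product, and the predicate $d_N$. $(H,d_N)$ is a model of $T_0$ if 1. $\sup_x\min\{1\dot- d_N(x),\ \inf_y\max\{|d_N(x)-\|x-y\||,\,d_N(y)\}\}=0$, 2. $\sup_x\sup_y\,[d_N(y)-\|x-y\|-d_N(x)]\le 0$. $(M,d_N)$ is *existentially closed* (among the models of $T_0$) if for every model $(H,d_N)\supseteq(M,d_N)$ of $T_0$, every quantifier-free $L_N$-formula $\psi(\bar x,\bar v)$, all radii $m_i$ and all $\bar e$ in $M$: if $\psi(\bar a,\bar e)=0$ for some $\bar a$ in $H$ with $\|a_i\|\le m_i$, then $\inf|\psi(\bar a',\bar e)|=0$, the infimum being over the $\bar a'$ in $M$ with $\|a'_i\|\le m_i$. **Locus formulas.** For $n,k\ge 0$ and an integer $L\ge 1$, consider tuples $\bar t=(\bar x,\bar y,\bar z,\bar u)$ with $\bar x,\bar z$ of length $n+k$ and $\bar y,\bar u$ of length $n$.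 A locus is given by a Gram matrix $G$ of such a tuple of vectors of norm $\le L$ in a Hilbert space, for which $z_i$ and $u_i$ are the orthogonal projections of $x_i$ and $y_i$ on $\operatorname{span}(\bar z\bar u)$, and $x_i\ne z_i$, $y_i\ne u_i$. Put $\varphi(\bar t)=\max_{i,j}|\langle t_i,t_j\rangle-G_{ij}|$. An *admissible* function for $\varphi$ is a continuous $f\colon[0,1]\to[0,1]$, positive on $(0,1)$, such that for all $\varepsilon\in(0,1)$ and all tuples $\bar t,\bar t'$ in Hilbert spaces with $\varphi(\bar t)<f(\varepsilon)$ and $\varphi(\bar t')=0$: $\|P_{\operatorname{span}(\bar z\bar u)}(x_i)-z_i\|<\varepsilon$, $\|P_{\operatorname{span}(\bar z\bar u)}(y_i)-u_i\|<\varepsilon$ and $\bigl|\|t_i-t_j\|-\|t'_i-t'_j\|\bigr|<\varepsilon$ for all $i,j$. For each $\varphi$ that has an admissible function, fix one, $f=f_\varphi$ (the choice is arbitrary). **The theory $T_N$.** $T_N$ consists of $T_0$, the axioms saying that the space is infinite-dimensional, and, for every such $\varphi$ and every $\varepsilon\in(0,1)\cap\mathbb Q$, with $\delta=2\sqrt{\varepsilon(L+2)}$,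 the axiom $\psi_{\varphi,\varepsilon}$, whose quantifiers range over the ball of radius $L+1$ and whose existential quantifiers are approximate ($\inf=0$), as usual in continuous logic: for all $\bar z,\bar u$, either * for all $\bar x,\bar y$ at least one of the following holds: $\varphi(\bar x,\bar y,\bar z,\bar u)\ge f(\varepsilon)$; or $\exists w\bigvee_{i\le n} d_N^2(w)\ge\|w-u_i\|^2+\|y_i-u_i\|^2+\varepsilon^2$; or $\|x_i-y_j\|^2\le\|x_i-z_i\|^2+d_N^2(z_i)+\varepsilon^2$ for some $i>n$, $j\le n$; or $\|x_i-y_j\|\le\|x_i-y_i\|-\varepsilon$ for some $i\neq j$, $i,j\le n$; or $\|x_i-z_i\|^2+d_N^2(z_i)\le\|x_i-y_i\|^2-\varepsilon^2$ for some $i\le n$; or * there are $\bar x,\bar y$ with $\varphi(\bar x,\bar y,\bar z,\bar u)\le f(\varepsilon)$; $d_N(y_i)\le\delta$ and $\bigl|d_N(x_i)-\min\{1,\|x_i-y_i\|\}\bigr|\le2\delta$ for $i\le n$; and $\bigl|d_N^2(x_i)-\min\{1,\|x_i-z_i\|^2+d_N^2(z_i)\}\bigr|\le4\delta L$ for $i>n$.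 **Theorem.** Assume that $(M,d_N)\models T_N$. Then $(M,d_N)$ is existentially closed among the models of $T_0$. -/

import Mathlib

open scoped RealInnerProductSpace

universe u v

namespace RandomSubset

/-! ### Quantifier-free formulas of the language of Hilbert spaces with a predicate `d_N` -/

/-- Terms of the language of real Hilbert spaces, with variables from `α`. -/
inductive LTerm (α : Type) : Type
  | var (a : α) : LTerm α
  | zero : LTerm α
  | add (s t : LTerm α) : LTerm α
  | smul (r : ℝ) (t : LTerm α) : LTerm α

/-- Quantifier-free formulas of continuous logic: atomic formulas are inner products, distances,
and values of `d_N`; connectives are the continuous functions `ℝ ^ m → ℝ`. -/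
inductive QFFormula (α : Type) : Type
  | inner (s t : LTerm α) : QFFormula α
  | dist (s t : LTerm α) : QFFormula α
  | dN (t : LTerm α) : QFFormula α
  | conn {m : ℕ} (g : C(Fin m → ℝ, ℝ)) (ψ : Fin m → QFFormula α) : QFFormula α

section Semantics

variable {α : Type} {H : Type u} [NormedAddCommGroup H] [InnerProductSpace ℝ H]

/-- Value of a term under an assignment. -/
def LTerm.realize (a : α → H) : LTerm α → H
  | .var i => a i
  | .zero => 0
  | .add s t => s.realize a + t.realize a
  | .smul r t => r • t.realize a

/-- Value of a quantifier-free formula in the structure `(H, d)` under an assignment. -/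
def QFFormula.realize (d : H → ℝ) (a : α → H) : QFFormula α → ℝ
  | .inner s t => ⟪s.realize a, t.realize a⟫
  | .dist s t => ‖s.realize a - t.realize a‖
  | .dN t => d (t.realize a)
  | .conn g ψ => g fun i => (ψ i).realize d a

end Semantics

/-! ### The basic theory -/

/-- `(H, d)` is a model of `T_0`. The space `H` is a real Hilbert space, `d` has values in `[0, 1]`,
and the two axioms of `T_0` hold. As always in continuous logic, `min A B = 0` (for `A, B ≥ 0`)
says that `A = 0` or `B = 0`, and `inf_y A = 0` says that `A ≤ τ` is satisfiable
for every `τ > 0`. -/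
structure IsModelT0 {H : Type u} [NormedAddCommGroup H] [InnerProductSpace ℝ H] [CompleteSpace H]
    (d : H → ℝ) : Prop where
  nonneg : ∀ x, 0 ≤ d x
  le_one : ∀ x, d x ≤ 1
  /-- `sup_x min {1 ∸ d x, inf_y max {|d x - ‖x - y‖|, d y}} = 0` -/
  approx_witness : ∀ x, 1 ≤ d x ∨ ∀ τ > 0, ∃ y, max |d x - ‖x - y‖| (d y) ≤ τ
  /-- `sup_x sup_y (d y - ‖x - y‖ - d x) ≤ 0` -/
  lipschitz : ∀ x y, d y - ‖x - y‖ - d x ≤ 0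

/-- `(M, d)` is existentially closed among the models of `T_0`: for every extension
`(H, dH)` of `(M, d)` that is a model of `T_0`, every quantifier-free formula `ψ(x, v)`, every
choice `B_{m i}` of sorts (balls) for the variables `x i`, and all parameters `e` in `M`: if
`ψ(x, e) = 0` has a solution in the balls of `H`, then `inf_x |ψ(x, e)| = 0` over the same
balls of `M`. -/
def IsExistentiallyClosed {M : Type u} [NormedAddCommGroup M] [InnerProductSpace ℝ M]
    (d : M → ℝ) : Prop :=
  ∀ (H : Type v) [NormedAddCommGroup H] [InnerProductSpace ℝ H] [CompleteSpace H]
    (dH : H → ℝ), IsModelT0 dH →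
  ∀ (i : M →ₗᵢ[ℝ] H), (∀ w, dH (i w) = d w) →
  ∀ (p l : ℕ) (ψ : QFFormula (Fin p ⊕ Fin l)) (m : Fin p → ℕ) (e : Fin l → M) (a : Fin p → H),
    (∀ s, ‖a s‖ ≤ m s) → ψ.realize dH (Sum.elim a fun s => i (e s)) = 0 →
    ∀ τ > 0, ∃ a' : Fin p → M, (∀ s, ‖a' s‖ ≤ m s) ∧ |ψ.realize d (Sum.elim a' e)| < τ

/-! ### Geometric locus formulas -/

/-- Index set of the points `x`: `inl` are the indices `i ≤ n`, `inr` the indices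
`n < i ≤ n + k`. -/
abbrev XIdx (n k : ℕ) : Type := Fin n ⊕ Fin k

/-- Index set of a tuple `(x, y, z, u)`. -/
abbrev TIdx (n k : ℕ) : Type := (XIdx n k ⊕ Fin n) ⊕ (XIdx n k ⊕ Fin n)

/-- The concatenation of `x, y, z, u`. -/
def concat {n k : ℕ} {E : Type u} (x : XIdx n k → E) (y : Fin n → E) (z : XIdx n k → E)
    (u : Fin n → E) : TIdx n k → E :=
  Sum.elim (Sum.elim x y) (Sum.elim z u)

/-- The subspace spanned by `z, u`. -/
def baseSpan {n k : ℕ} {E : Type u} [NormedAddCommGroup E] [InnerProductSpace ℝ E]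
    (z : XIdx n k → E) (u : Fin n → E) : Submodule ℝ E :=
  Submodule.span ℝ (Set.range z ∪ Set.range u)

/-- A Hilbert space geometric locus `φ(x, y, z, u) = 0`: prescribed values of all inner products
between the entries of a tuple `(x, y, z, u)`. The values are those of an actual tuple,
contained in the ball of radius `L`, in which `z i` and `u i` are the orthogonal projections of
`x i` and `y i` on a subspace (it is the same to say: on the span of `z, u`) not containing any
`x i` or `y i`. -/
structure LocusFormula where
  n : ℕ
  k : ℕ
  L : ℕ
  L_pos : 0 < L
  gram : TIdx n k → TIdx n k → ℝ
  realizable : ∃ (N : ℕ) (x : XIdx n k → EuclideanSpace ℝ (Fin N))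
    (y : Fin n → EuclideanSpace ℝ (Fin N)) (z : XIdx n k → EuclideanSpace ℝ (Fin N))
    (u : Fin n → EuclideanSpace ℝ (Fin N)),
    (∀ i j, ⟪concat x y z u i, concat x y z u j⟫ = gram i j) ∧
    (∀ i, ‖concat x y z u i‖ ≤ L) ∧
    (∀ i, (baseSpan z u).starProjection (x i) = z i ∧ x i ≠ z i) ∧
    (∀ i, (baseSpan z u).starProjection (y i) = u i ∧ y i ≠ u i)

/-- The value `φ(t) = max_{i,j} |⟪t i, t j⟫ - gram i j|` (the norm below is the maximum norm). -/
noncomputable def LocusFormula.value (φ : LocusFormula) {E : Type u} [NormedAddCommGroup E]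
    [InnerProductSpace ℝ E] (t : TIdx φ.n φ.k → E) : ℝ :=
  ‖fun p : TIdx φ.n φ.k × TIdx φ.n φ.k => ⟪t p.1, t p.2⟫ - φ.gram p.1 p.2‖

/-- `f : [0, 1] → [0, 1]` is continuous, positive on `(0, 1)`, and has the properties
(a), (b), (c) with respect to `φ`. Here `t = (x, y, z, u)` and `t'` are tuples in arbitrary
Hilbert spaces; as they are finite, Euclidean spaces suffice. -/
structure IsModulus (φ : LocusFormula) (f : ℝ → ℝ) : Prop where
  continuousOn : ContinuousOn f (Set.Icc 0 1)
  mapsTo : Set.MapsTo f (Set.Icc 0 1) (Set.Icc 0 1)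
  pos : ∀ ε ∈ Set.Ioo (0 : ℝ) 1, 0 < f ε
  close : ∀ ε ∈ Set.Ioo (0 : ℝ) 1, ∀ (N N' : ℕ)
    (x : XIdx φ.n φ.k → EuclideanSpace ℝ (Fin N)) (y : Fin φ.n → EuclideanSpace ℝ (Fin N))
    (z : XIdx φ.n φ.k → EuclideanSpace ℝ (Fin N)) (u : Fin φ.n → EuclideanSpace ℝ (Fin N))
    (t' : TIdx φ.n φ.k → EuclideanSpace ℝ (Fin N')),
    φ.value (concat x y z u) < f ε → φ.value t' = 0 →
      (∀ i, ‖(baseSpan z u).starProjection (x i) - z i‖ < ε) ∧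
      (∀ i, ‖(baseSpan z u).starProjection (y i) - u i‖ < ε) ∧
      (∀ i j, |‖concat x y z u i - concat x y z u j‖ - ‖t' i - t' j‖| < ε)

/-- `F` chooses a function `f` as in `IsModulus` for every locus that has one. -/
def IsModulusChoice (F : LocusFormula → ℝ → ℝ) : Prop :=
  ∀ φ, (∃ f, IsModulus φ f) → IsModulus φ (F φ)

/-! ### The theory `T_N` -/

/-- The axiom `ψ_{φ, ε}` for the threshold `r = f(ε)`, in the structure `(M, d)`. All quantifiers
range over the ball of radius `L + 1`, and existential quantifiers are approximate
(`inf = 0`), as in continuous logic. Since `d` is truncated at one, so are the values that are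
prescribed for it in the last two lines. -/
def SatisfiesAxiom {M : Type u} [NormedAddCommGroup M] [InnerProductSpace ℝ M] (d : M → ℝ)
    (φ : LocusFormula) (ε r : ℝ) : Prop :=
  let δ : ℝ := 2 * √(ε * (φ.L + 2))
  ∀ (z : XIdx φ.n φ.k → M) (u : Fin φ.n → M),
    (∀ i, ‖z i‖ ≤ φ.L + 1) → (∀ i, ‖u i‖ ≤ φ.L + 1) →
    (∀ (x : XIdx φ.n φ.k → M) (y : Fin φ.n → M),
      (∀ i, ‖x i‖ ≤ φ.L + 1) → (∀ i, ‖y i‖ ≤ φ.L + 1) →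
        r ≤ φ.value (concat x y z u) ∨
        (∀ τ > 0, ∃ w : M, ‖w‖ ≤ φ.L + 1 ∧
          ∃ i, ‖w - u i‖ ^ 2 + ‖y i - u i‖ ^ 2 + ε ^ 2 ≤ d w ^ 2 + τ) ∨
        (∃ (i : Fin φ.k) (j : Fin φ.n),
          ‖x (.inr i) - y j‖ ^ 2 ≤ ‖x (.inr i) - z (.inr i)‖ ^ 2 + d (z (.inr i)) ^ 2 + ε ^ 2) ∨
        (∃ i j : Fin φ.n, j ≠ i ∧ ‖x (.inl i) - y j‖ ≤ ‖x (.inl i) - y i‖ - ε) ∨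
        (∃ i : Fin φ.n, ‖x (.inl i) - z (.inl i)‖ ^ 2 + d (z (.inl i)) ^ 2 ≤
          ‖x (.inl i) - y i‖ ^ 2 - ε ^ 2)) ∨
    (∀ τ > 0, ∃ (x : XIdx φ.n φ.k → M) (y : Fin φ.n → M),
      (∀ i, ‖x i‖ ≤ φ.L + 1) ∧ (∀ i, ‖y i‖ ≤ φ.L + 1) ∧
        φ.value (concat x y z u) ≤ r + τ ∧
        (∀ i, d (y i) ≤ δ + τ) ∧
        (∀ i : Fin φ.n, |d (x (.inl i)) - min 1 ‖x (.inl i) - y i‖| ≤ 2 * δ + τ) ∧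
        (∀ i : Fin φ.k, |d (x (.inr i)) ^ 2 -
          min 1 (‖x (.inr i) - z (.inr i)‖ ^ 2 + d (z (.inr i)) ^ 2)| ≤ 4 * δ * φ.L + τ))

/-- `(M, d)` is a model of `T_N`, where the functions `f` in the axioms are those chosen by
`F`: an infinite-dimensional model of `T_0` in which all axioms `ψ_{φ, ε}` hold. -/
structure IsModelTN (F : LocusFormula → ℝ → ℝ) {M : Type u} [NormedAddCommGroup M]
    [InnerProductSpace ℝ M] [CompleteSpace M] (d : M → ℝ) : Prop where
  isModelT0 : IsModelT0 d
  infinite_dimensional : ¬ FiniteDimensional ℝ M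
  scheme : ∀ φ : LocusFormula, (∃ f, IsModulus φ f) →
    ∀ ε : ℚ, 0 < ε → ε < 1 → SatisfiesAxiom d φ ε (F φ ε)

end RandomSubset

/-!
Let `(M, d)` be a model of `T_N`, let `(H, dH)` be an extension of it that is a model of `T_0`, and
let `ψ` have a solution in `H`. The value of a quantifier-free formula depends continuously on
the inner products of the variables and on the values of `d` at finitely many terms
(`QFFormula.tendsto_realize`). So it is enough to imitate finitely many points of `H` by points of
`M`, with almost the same inner products and values of `d`, and such that points of `M` are kept
(`IsModelTN.exists_approx`).

For points outside `M`, let `π` be the projection on `M`. Since `H` is complete, `dH` is the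
truncated distance to the set of black points, the zeros of `dH`. The black points of `M` yield
`dH x ^ 2 ≤ ‖x - π x‖ ^ 2 + d (π x) ^ 2`. Where this is strict and `dH x < 1`, a
black point outside `M` nearly realizes `dH x`. Collect these points in a finite set `Y`, and divide
the given points `x` into those that have a point of `Y` at squared distance at most
`‖x - π x‖ ^ 2 + d (π x) ^ 2`, which are assigned a nearest point of `Y`, and the others, for which
`dH x ^ 2` is `min 1 (‖x - π x‖ ^ 2 + d (π x) ^ 2)` (`IsModelT0.exists_black_points`). These are the
two kinds of points `x i` in the axioms, and the assigned points are the `y i`.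

As `M` is infinite-dimensional, it contains an isometric copy of the whole tuple over the base of
projections. This copy refutes the first alternative of the axiom, so the second
alternative provides the imitation (`IsModelTN.exists_approx_tuple`). Two difficulties arise. A
locus whose base is linearly dependent has no modulus in general; therefore the base is perturbed by
`ν • g` with `g` orthonormal, after which `c * ε ^ 2` is a modulus for small `c`
(`LocusFormula.exists_isModulus`). The perturbation `ν` must be small compared to `ε ^ 2`, while
`ε` must be so small that the chosen modulus of the perturbed locus is small at `ε`. This is not
circular: every modulus is bounded by a linear function of `ε` whose slope depends only on the
radius and on one distance `‖x i - z i‖` or `‖y i - u i‖`, neither of which is affected by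
the perturbation (`IsModulus.le_linear`).
-/

namespace RandomSubset

open Filter Topology

/-! ### Gram matrices and projections in inner product spaces -/

section InnerProduct

variable {ι : Type*} {E : Type*} [NormedAddCommGroup E] [InnerProductSpace ℝ E]

lemma exists_euclideanSpace_gram_eq [Finite ι] (t : ι → E) :
    ∃ (N : ℕ) (s : ι → EuclideanSpace ℝ (Fin N)), ∀ i j, ⟪s i, s j⟫ = ⟪t i, t j⟫ := by
  let V := Submodule.span ℝ (Set.range t)
  have : FiniteDimensional ℝ V := FiniteDimensional.span_of_finite ℝ (Set.finite_range t)
  let b := stdOrthonormalBasis ℝ V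
  refine ⟨_, fun i => b.repr ⟨t i, Submodule.subset_span ⟨i, rfl⟩⟩, fun i j => ?_⟩
  rw [b.repr.inner_map_map]
  rfl

lemma exists_orthonormal_mem_orthogonal (hE : ¬ FiniteDimensional ℝ E) (K : Submodule ℝ E)
    [FiniteDimensional ℝ K] (N : ℕ) :
    ∃ o : Fin N → E, Orthonormal ℝ o ∧ ∀ j, o j ∈ Kᗮ := by
  have hK : ¬ FiniteDimensional ℝ Kᗮ := by
    intro h
    apply hE
    have : FiniteDimensional ℝ (K ⊔ Kᗮ : Submodule ℝ E) := inferInstance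
    rw [Submodule.sup_orthogonal_of_hasOrthogonalProjection] at this
    exact Module.Finite.equiv Submodule.topEquiv
  have hr : (N : Cardinal) ≤ Module.rank ℝ Kᗮ := by
    rw [FiniteDimensional, ← Module.rank_lt_aleph0_iff, not_lt] at hK
    exact (Cardinal.natCast_lt_aleph0.le).trans hK
  obtain ⟨l, hl⟩ := exists_finset_linearIndependent_of_le_rank hr
  let v : Fin N → Kᗮ := fun j => (l.equivFinOfCardEq hl.1).symm j
  have hv : LinearIndependent ℝ v := hl.2.comp _ (Equiv.injective _)
  have ho := InnerProductSpace.gramSchmidtNormed_orthonormal (𝕜 := ℝ) hv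
  exact ⟨fun j => (InnerProductSpace.gramSchmidtNormed ℝ v j : Kᗮ),
    ho.comp_linearIsometry Kᗮ.subtypeₗᵢ, fun j => Subtype.coe_prop _⟩

/-- An infinite-dimensional space contains an isometric copy of any finite tuple,
orthogonal to a given finite-dimensional subspace. -/
lemma exists_mem_orthogonal_gram_eq [Finite ι] (hE : ¬ FiniteDimensional ℝ E) (K : Submodule ℝ E)
    [FiniteDimensional ℝ K] {H : Type*} [NormedAddCommGroup H] [InnerProductSpace ℝ H]
    (t : ι → H) : ∃ s : ι → E, (∀ i j, ⟪s i, s j⟫ = ⟪t i, t j⟫) ∧ ∀ i, s i ∈ Kᗮ := by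
  obtain ⟨N, r, hr⟩ := exists_euclideanSpace_gram_eq t
  obtain ⟨o, ho, hoK⟩ := exists_orthonormal_mem_orthogonal hE K N
  refine ⟨fun i => ∑ j, r i j • o j, fun i j => ?_, fun i => ?_⟩
  · rw [ho.inner_sum, ← hr]
    simp [PiLp.inner_apply, mul_comm]
  · exact Submodule.sum_mem _ fun j _ => Submodule.smul_mem _ _ (hoK j)

lemma exists_orthonormal_orthogonal_range [Finite ι] {κ : Type*} [Finite κ]
    (hE : ¬ FiniteDimensional ℝ E) (w : κ → E) :
    ∃ g : ι → E, Orthonormal ℝ g ∧ ∀ i j, ⟪w j, g i⟫ = 0 := by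
  classical
  have : FiniteDimensional ℝ (Submodule.span ℝ (Set.range w)) :=
    FiniteDimensional.span_of_finite ℝ (Set.finite_range w)
  obtain ⟨m, ⟨e⟩⟩ := Finite.exists_equiv_fin ι
  obtain ⟨o, ho, hoK⟩ := exists_orthonormal_mem_orthogonal hE (Submodule.span ℝ (Set.range w)) m
  exact ⟨o ∘ e, ho.comp _ e.injective, fun i j =>
    (Submodule.mem_orthogonal _ _).1 (hoK (e i)) _ (Submodule.subset_span ⟨j, rfl⟩)⟩

lemma starProjection_span_eq {W : ι → E} {x z : E}
    [(Submodule.span ℝ (Set.range W)).HasOrthogonalProjection]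
    (hz : z ∈ Submodule.span ℝ (Set.range W)) (h : ∀ i, ⟪x - z, W i⟫ = 0) :
    (Submodule.span ℝ (Set.range W)).starProjection x = z := by
  refine (Submodule.eq_starProjection_of_mem_of_inner_eq_zero hz fun w hw => ?_)
  induction hw using Submodule.span_induction with
  | mem w hw => obtain ⟨i, rfl⟩ := hw; exact h i
  | zero => simp
  | add a b _ _ ha hb => rw [inner_add_right, ha, hb, add_zero]
  | smul r a _ ha => rw [inner_smul_right, ha, mul_zero]

lemma sq_norm_sum_smul [Fintype ι] (c : ι → ℝ) (W : ι → E) :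
    ‖∑ i, c i • W i‖ ^ 2 = ∑ i, ∑ j, c i * c j * ⟪W i, W j⟫ := by
  rw [← real_inner_self_eq_norm_sq, sum_inner]
  refine Finset.sum_congr rfl fun i _ => ?_
  rw [inner_sum]
  refine Finset.sum_congr rfl fun j _ => ?_
  rw [real_inner_smul_left, real_inner_smul_right]
  ring

lemma sq_norm_sub_eq_gram (x y : E) : ‖x - y‖ ^ 2 = ⟪x, x⟫ - 2 * ⟪x, y⟫ + ⟪y, y⟫ := by
  rw [norm_sub_sq_real, real_inner_self_eq_norm_sq, real_inner_self_eq_norm_sq]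

lemma sq_sum_abs_le [Fintype ι] (c : ι → ℝ) :
    (∑ i, |c i|) ^ 2 ≤ Fintype.card ι * ∑ i, c i ^ 2 := by
  simpa only [sq_abs, Finset.card_univ] using
    sq_sum_le_card_mul_sum_sq (s := Finset.univ) (f := fun i => |c i|)

/-- If `W` is quantitatively linearly independent and `x - z` is almost orthogonal to `W`, where
`z` is in the span of `W`, then `z` is close to the projection of `x` on this span. -/
lemma sq_norm_starProjection_sub_le [Fintype ι] {W : ι → E} {x z : E} {lam v : ℝ}
    [(Submodule.span ℝ (Set.range W)).HasOrthogonalProjection]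
    (hz : z ∈ Submodule.span ℝ (Set.range W)) (hlam : 0 < lam)
    (hx : ∀ i, |⟪W i, x - z⟫| ≤ v) (hW : ∀ c : ι → ℝ, lam * ∑ i, c i ^ 2 ≤ ‖∑ i, c i • W i‖ ^ 2) :
    lam * ‖(Submodule.span ℝ (Set.range W)).starProjection x - z‖ ^ 2 ≤
      Fintype.card ι * v ^ 2 := by
  set P := (Submodule.span ℝ (Set.range W)).starProjection
  have hmem : P x - z ∈ Submodule.span ℝ (Set.range W) :=
    Submodule.sub_mem _ (Submodule.starProjection_apply_mem _ _) hz
  obtain ⟨c, hc⟩ := (Submodule.mem_span_range_iff_exists_fun ℝ).1 hmem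
  have h1 : ‖P x - z‖ ^ 2 = ∑ i, c i * ⟪W i, x - z⟫ := by
    have h0 : ⟪P x - z, x - P x⟫ = 0 := by
      rw [real_inner_comm]
      exact Submodule.starProjection_inner_eq_zero _ _ hmem
    have : ⟪P x - z, x - z⟫ = ⟪P x - z, P x - z⟫ := by
      rw [show x - z = (x - P x) + (P x - z) by abel, inner_add_right, h0, zero_add]
    rw [← real_inner_self_eq_norm_sq, ← this]
    conv_lhs => rw [← hc]
    rw [sum_inner]
    simp only [real_inner_smul_left]
  have h2 : ‖P x - z‖ ^ 2 ≤ v * ∑ i, |c i| := by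
    rw [h1, Finset.mul_sum]
    refine Finset.sum_le_sum fun i _ => (le_abs_self _).trans ?_
    rw [abs_mul, mul_comm]
    exact mul_le_mul_of_nonneg_right (hx i) (abs_nonneg _)
  have h3 := sq_sum_abs_le c
  have h4 := hW c
  rw [hc] at h4
  rcases (sq_nonneg ‖P x - z‖).eq_or_lt with h0 | h0
  · rw [← h0, mul_zero]
    positivity
  · refine le_of_mul_le_mul_right ?_ h0
    calc lam * ‖P x - z‖ ^ 2 * ‖P x - z‖ ^ 2 = lam * (‖P x - z‖ ^ 2) ^ 2 := by ring
      _ ≤ lam * (v * ∑ i, |c i|) ^ 2 := by gcongr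
      _ = lam * v ^ 2 * (∑ i, |c i|) ^ 2 := by ring
      _ ≤ lam * v ^ 2 * (Fintype.card ι * ∑ i, c i ^ 2) := by gcongr
      _ = Fintype.card ι * v ^ 2 * (lam * ∑ i, c i ^ 2) := by ring
      _ ≤ Fintype.card ι * v ^ 2 * ‖P x - z‖ ^ 2 := by gcongr

lemma abs_sub_le_sqrt_of_abs_sq_sub_le {a b c : ℝ} (ha : 0 ≤ a) (hb : 0 ≤ b)
    (h : |a ^ 2 - b ^ 2| ≤ c) : |a - b| ≤ √c := by
  refine Real.abs_le_sqrt (le_trans ?_ h)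
  rw [show a ^ 2 - b ^ 2 = (a - b) * (a + b) by ring, abs_mul, ← sq_abs, sq]
  refine mul_le_mul_of_nonneg_left ?_ (abs_nonneg _)
  rw [abs_of_nonneg (add_nonneg ha hb)]
  exact abs_sub_le_of_nonneg_of_le ha (by linarith) hb (by linarith)

end InnerProduct

/-! ### Geometric loci and their moduli -/

section Locus

variable {n k : ℕ}

lemma concat_comp_inl_inr {E : Type u} (t : TIdx n k → E) :
    concat (fun i => t (.inl (.inl i))) (fun i => t (.inl (.inr i)))
      (fun i => t (.inr (.inl i))) (fun i => t (.inr (.inr i))) = t := by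
  ext ((i | i) | (i | i)) <;> rfl

lemma baseSpan_eq_span_range {E : Type u} [NormedAddCommGroup E] [InnerProductSpace ℝ E]
    (x : XIdx n k → E) (y : Fin n → E) (z : XIdx n k → E) (u : Fin n → E) :
    baseSpan z u = Submodule.span ℝ (Set.range fun b => concat x y z u (.inr b)) := by
  rw [baseSpan, ← Set.Sum.elim_range]
  rfl

/-- The locus of the Gram matrix of a tuple `t` in an arbitrary inner product space. The first half
`t ∘ inl` of the tuple lists `x` and `y`, the second half `t ∘ inr` lists their projections
`z` and `u`. -/
def LocusFormula.ofTuple {E : Type u} [NormedAddCommGroup E] [InnerProductSpace ℝ E]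
    (t : TIdx n k → E) (L : ℕ) (hL : 0 < L) (hle : ∀ i, ‖t i‖ ≤ L)
    (hne : ∀ b, t (.inl b) ≠ t (.inr b))
    (horth : ∀ b b', ⟪t (.inl b) - t (.inr b), t (.inr b')⟫ = 0) : LocusFormula where
  n := n
  k := k
  L := L
  L_pos := hL
  gram i j := ⟪t i, t j⟫
  realizable := by
    obtain ⟨N, s, hs⟩ := exists_euclideanSpace_gram_eq t
    have hP : ∀ b, (baseSpan (fun i => s (.inr (.inl i)))
        (fun i => s (.inr (.inr i)))).starProjection (s (.inl b)) = s (.inr b) := by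
      intro b
      simp_rw [baseSpan_eq_span_range (fun i => s (.inl (.inl i))) (fun i => s (.inl (.inr i)))
        (fun i => s (.inr (.inl i))) (fun i => s (.inr (.inr i))), concat_comp_inl_inr]
      refine starProjection_span_eq (Submodule.subset_span ⟨b, rfl⟩) fun b' => ?_
      rw [← horth b b', inner_sub_left, inner_sub_left, hs, hs]
    have hsne : ∀ b, s (.inl b) ≠ s (.inr b) := by
      intro b hb
      apply hne b
      rw [← sub_eq_zero, ← norm_eq_zero, ← sq_eq_zero_iff, sq_norm_sub_eq_gram, ← hs, ← hs, ← hs,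
        hb]
      ring
    refine ⟨N, fun i => s (.inl (.inl i)), fun i => s (.inl (.inr i)),
      fun i => s (.inr (.inl i)), fun i => s (.inr (.inr i)), ?_, ?_,
      fun i => ⟨hP _, hsne _⟩, fun i => ⟨hP _, hsne _⟩⟩
    · rw [concat_comp_inl_inr]
      exact hs
    · rw [concat_comp_inl_inr]
      intro i
      refine le_trans (le_of_eq ?_) (hle i)
      rw [norm_eq_sqrt_real_inner, norm_eq_sqrt_real_inner, hs]

variable {φ : LocusFormula} {E : Type u} [NormedAddCommGroup E] [InnerProductSpace ℝ E]

lemma LocusFormula.value_nonneg (t : TIdx φ.n φ.k → E) : 0 ≤ φ.value t := norm_nonneg _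

lemma LocusFormula.abs_inner_sub_gram_le (t : TIdx φ.n φ.k → E) (i j : TIdx φ.n φ.k) :
    |⟪t i, t j⟫ - φ.gram i j| ≤ φ.value t :=
  norm_le_pi_norm (fun p : TIdx φ.n φ.k × TIdx φ.n φ.k => ⟪t p.1, t p.2⟫ - φ.gram p.1 p.2) (i, j)

lemma LocusFormula.value_le {t : TIdx φ.n φ.k → E} {r : ℝ} (hr : 0 ≤ r)
    (h : ∀ i j, |⟪t i, t j⟫ - φ.gram i j| ≤ r) : φ.value t ≤ r :=
  (pi_norm_le_iff_of_nonneg hr).2 fun p => h p.1 p.2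

/-- The values of `φ` control the squared distances of the entries of a tuple. -/
lemma LocusFormula.abs_sq_norm_sub_sub_le (t : TIdx φ.n φ.k → E) (i j : TIdx φ.n φ.k) :
    |‖t i - t j‖ ^ 2 - (φ.gram i i - 2 * φ.gram i j + φ.gram j j)| ≤ 4 * φ.value t := by
  rw [sq_norm_sub_eq_gram]
  have h1 := abs_le.1 (φ.abs_inner_sub_gram_le t i i)
  have h2 := abs_le.1 (φ.abs_inner_sub_gram_le t i j)
  have h3 := abs_le.1 (φ.abs_inner_sub_gram_le t j j)
  rw [abs_le]
  constructor <;> linarith [h1.1, h1.2, h2.1, h2.2, h3.1, h3.2]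

variable (φ) in
lemma LocusFormula.exists_tuple : ∃ (N : ℕ) (t : TIdx φ.n φ.k → EuclideanSpace ℝ (Fin N)),
    (∀ i j, ⟪t i, t j⟫ = φ.gram i j) ∧ (∀ i, ‖t i‖ ≤ φ.L) ∧
      ∀ b b', ⟪t (.inl b) - t (.inr b), t (.inr b')⟫ = 0 := by
  obtain ⟨N, x, y, z, u, hG, hL, hx, hy⟩ := φ.realizable
  have hmem : ∀ b', concat x y z u (.inr b') ∈ baseSpan z u := by
    rintro (i | i)
    · exact Submodule.subset_span (.inl ⟨i, rfl⟩)
    · exact Submodule.subset_span (.inr ⟨i, rfl⟩)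
  refine ⟨N, concat x y z u, hG, hL, ?_⟩
  rintro (i | i) b'
  · have := Submodule.starProjection_inner_eq_zero (K := baseSpan z u) (x i) _ (hmem b')
    rwa [(hx i).1] at this
  · have := Submodule.starProjection_inner_eq_zero (K := baseSpan z u) (y i) _ (hmem b')
    rwa [(hy i).1] at this

/-- If the Gram matrix of the base `(z, u)` of a locus is positive definite, then the locus has a
modulus, namely `c * ε ^ 2` for a small constant `c`. -/
lemma LocusFormula.exists_isModulus {lam : ℝ} (hlam : 0 < lam)
    (h : ∀ c : XIdx φ.n φ.k ⊕ Fin φ.n → ℝ,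
      lam * ∑ b, c b ^ 2 ≤ ∑ b, ∑ b', c b * c b' * φ.gram (.inr b) (.inr b')) :
    ∃ f, IsModulus φ f := by
  set m : ℝ := ((Fintype.card (XIdx φ.n φ.k ⊕ Fin φ.n) : ℕ) : ℝ) with hm
  have hm0 : 0 ≤ m := by positivity
  obtain ⟨c₀, hc₀, hc1, hc2⟩ : ∃ c₀ : ℝ, 0 < c₀ ∧ c₀ ≤ 1 / 4 ∧ c₀ * m ≤ lam / 4 := by
    refine ⟨min (1 / 4) (lam / (4 * (m + 1))), by positivity, min_le_left _ _, ?_⟩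
    calc _ ≤ lam / (4 * (m + 1)) * m := by gcongr; exact min_le_right _ _
      _ = lam / 4 * (m / (m + 1)) := by field_simp
      _ ≤ lam / 4 * 1 := by gcongr; exact div_le_one_of_le₀ (by linarith) (by linarith)
      _ = _ := mul_one _
  refine ⟨fun ε => c₀ * ε ^ 2, by fun_prop, fun ε hε => ⟨by positivity, ?_⟩,
    fun ε hε => mul_pos hc₀ (pow_pos hε.1 2), ?_⟩
  · have : ε ^ 2 ≤ 1 := pow_le_one₀ hε.1 hε.2
    change c₀ * ε ^ 2 ≤ 1
    nlinarith
  intro ε hε N N' x y z u t' hv ht'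
  set t := concat x y z u
  set val := φ.value t
  have hv0 : 0 ≤ val := φ.value_nonneg t
  have hε2 : ε ^ 2 ≤ ε := by nlinarith [hε.1, hε.2]
  have hvc : val ≤ c₀ := by nlinarith [hε.1, hε.2]
  have hW : ∀ c : XIdx φ.n φ.k ⊕ Fin φ.n → ℝ,
      lam / 2 * ∑ b, c b ^ 2 ≤ ‖∑ b, c b • t (.inr b)‖ ^ 2 := by
    intro c
    rw [sq_norm_sum_smul]
    have h1 : ∑ b, ∑ b', c b * c b' * φ.gram (.inr b) (.inr b') -
        ∑ b, ∑ b', c b * c b' * ⟪t (.inr b), t (.inr b')⟫ ≤ val * (∑ b, |c b|) ^ 2 := by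
      rw [sq, Finset.sum_mul_sum, Finset.mul_sum, ← Finset.sum_sub_distrib]
      refine Finset.sum_le_sum fun b _ => ?_
      rw [Finset.mul_sum, ← Finset.sum_sub_distrib]
      refine Finset.sum_le_sum fun b' _ => ?_
      rw [← mul_sub, ← abs_mul, mul_comm val]
      refine (le_abs_self _).trans ?_
      rw [abs_mul, abs_sub_comm]
      exact mul_le_mul_of_nonneg_left (φ.abs_inner_sub_gram_le t _ _) (abs_nonneg _)
    have h3 : (∑ b, |c b|) ^ 2 ≤ m * ∑ b, c b ^ 2 := sq_sum_abs_le c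
    have h4 : val * (∑ b, |c b|) ^ 2 ≤ lam / 4 * ∑ b, c b ^ 2 :=
      calc _ ≤ c₀ * (m * ∑ b, c b ^ 2) := by gcongr
        _ = c₀ * m * ∑ b, c b ^ 2 := by ring
        _ ≤ _ := mul_le_mul_of_nonneg_right hc2 (Finset.sum_nonneg fun b _ => sq_nonneg _)
    have h5 : 0 ≤ ∑ b, c b ^ 2 := Finset.sum_nonneg fun b _ => sq_nonneg _
    nlinarith [h c]
  have hproj : ∀ b, ‖(baseSpan z u).starProjection (t (.inl b)) - t (.inr b)‖ < ε := by
    obtain ⟨N₀, t₀, hG₀, -, ho₀⟩ := φ.exists_tuple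
    intro b
    simp_rw [baseSpan_eq_span_range x y z u]
    have hx : ∀ b', |⟪t (.inr b'), t (.inl b) - t (.inr b)⟫| ≤ 2 * val := by
      intro b'
      have h0 := ho₀ b b'
      rw [inner_sub_left, hG₀, hG₀] at h0
      rw [real_inner_comm, inner_sub_left]
      have h1 := abs_le.1 (φ.abs_inner_sub_gram_le t (.inl b) (.inr b'))
      have h2 := abs_le.1 (φ.abs_inner_sub_gram_le t (.inr b) (.inr b'))
      rw [abs_le]
      constructor <;> linarith [h1.1, h1.2, h2.1, h2.2]
    have h1 := sq_norm_starProjection_sub_le (W := fun b => t (.inr b))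
      (Submodule.subset_span ⟨b, rfl⟩) (half_pos hlam) hx hW
    refine lt_of_pow_lt_pow_left₀ 2 hε.1.le (lt_of_mul_lt_mul_left ?_ (half_pos hlam).le)
    refine h1.trans_lt ?_
    rw [← hm]
    have h2 : val ^ 2 ≤ c₀ * val := by rw [sq]; gcongr
    calc m * (2 * val) ^ 2 = 4 * m * val ^ 2 := by ring
      _ ≤ 4 * m * (c₀ * val) := by gcongr
      _ = 4 * (c₀ * m) * val := by ring
      _ ≤ 4 * (lam / 4) * val := by gcongr
      _ < 4 * (lam / 4) * (c₀ * ε ^ 2) := by gcongr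
      _ ≤ lam / 2 * ε ^ 2 := by nlinarith [mul_pos hlam (pow_pos hε.1 2)]
  refine ⟨fun i => hproj (.inl i), fun i => hproj (.inr i), fun i j => ?_⟩
  have h1 := abs_le.1 (φ.abs_sq_norm_sub_sub_le t i j)
  have h2 := abs_le.1 (φ.abs_sq_norm_sub_sub_le t' i j)
  rw [ht', mul_zero] at h2
  have h3 : |‖t i - t j‖ ^ 2 - ‖t' i - t' j‖ ^ 2| ≤ 4 * val := by
    rw [abs_le]
    constructor <;> linarith [h1.1, h1.2, h2.1, h2.2]
  refine (abs_sub_le_sqrt_of_abs_sq_sub_le (norm_nonneg _) (norm_nonneg _) h3).trans_lt ?_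
  rw [Real.sqrt_lt' hε.1]
  nlinarith [pow_pos hε.1 2]

/-- Every modulus is bounded by a linear function. The bound depends only on the
radius `L` and on one nonzero distance `a` between entries of the locus: scaling the
tuple by `1 + ε / a` moves this distance by `ε`, and the Gram matrix by at most
`3 * L ^ 2 * ε / a`. -/
lemma IsModulus.le_linear {f : ℝ → ℝ} (hf : IsModulus φ f) {i j : TIdx φ.n φ.k} {a : ℝ}
    (ha : 0 < a) (hij : φ.gram i i - 2 * φ.gram i j + φ.gram j j = a ^ 2) {ε : ℝ}
    (hε : ε ∈ Set.Ioo (0 : ℝ) 1) (hεa : ε ≤ a) : f ε ≤ 3 * φ.L ^ 2 * (ε / a) := by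
  by_contra! hlt
  obtain ⟨N, t, hG, hL, -⟩ := φ.exists_tuple
  set s : ℝ := ε / a with hs
  have hs0 : 0 < s := div_pos hε.1 ha
  have hs1 : s ≤ 1 := div_le_one_of_le₀ hεa ha.le
  have hdist : ‖t i - t j‖ = a := by
    rw [← sq_eq_sq₀ (norm_nonneg _) ha.le, sq_norm_sub_eq_gram, hG, hG, hG, hij]
  have hval : φ.value (fun l => (1 + s) • t l) ≤ 3 * φ.L ^ 2 * s := by
    refine φ.value_le (by positivity) fun l l' => ?_
    rw [real_inner_smul_left, real_inner_smul_right, ← hG,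
      show (1 + s) * ((1 + s) * ⟪t l, t l'⟫) - ⟪t l, t l'⟫ = (2 * s + s ^ 2) * ⟪t l, t l'⟫ by ring,
      abs_mul, abs_of_nonneg (by positivity)]
    have h1 : |⟪t l, t l'⟫| ≤ (φ.L : ℝ) ^ 2 := by
      rw [sq]
      exact (abs_real_inner_le_norm _ _).trans
        (mul_le_mul (hL l) (hL l') (norm_nonneg _) (Nat.cast_nonneg _))
    calc _ ≤ (3 * s) * (φ.L : ℝ) ^ 2 := mul_le_mul (by nlinarith) h1 (abs_nonneg _) (by positivity)
      _ = _ := by ring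
  have hval0 : φ.value t = 0 :=
    le_antisymm (φ.value_le le_rfl fun l l' => by simp [hG]) (φ.value_nonneg t)
  have h := (hf.close ε hε N N (fun l => (1 + s) • t (.inl (.inl l)))
    (fun l => (1 + s) • t (.inl (.inr l))) (fun l => (1 + s) • t (.inr (.inl l)))
    (fun l => (1 + s) • t (.inr (.inr l))) t
    (by rw [concat_comp_inl_inr (fun l => (1 + s) • t l)]; exact hval.trans_lt hlt) hval0).2.2 i j
  rw [concat_comp_inl_inr (fun l => (1 + s) • t l), ← smul_sub, norm_smul, hdist,
    Real.norm_of_nonneg (by positivity), show (1 + s) * a - a = ε by rw [hs]; field_simp; ring,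
    abs_of_pos hε.1] at h
  exact lt_irrefl _ h

end Locus

/-! ### Realizing a locus with prescribed values of `d` -/

section Transfer

variable {M : Type u} [NormedAddCommGroup M] [InnerProductSpace ℝ M] {d : M → ℝ}

lemma IsModelT0.abs_sub_le [CompleteSpace M] (hd : IsModelT0 d) (x y : M) :
    |d x - d y| ≤ ‖x - y‖ := by
  have h1 := hd.lipschitz x y
  have h2 := hd.lipschitz y x
  rw [norm_sub_rev] at h2
  rw [_root_.abs_le]
  constructor <;> linarith

lemma IsModelT0.continuous [CompleteSpace M] (hd : IsModelT0 d) : Continuous d := by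
  refine (LipschitzWith.of_dist_le_mul (K := 1) fun x y => ?_).continuous
  rw [Real.dist_eq, dist_eq_norm, NNReal.coe_one, one_mul]
  exact hd.abs_sub_le x y

/-- An exact realization of the locus in `M` refutes the first alternative of the axiom as soon as
it satisfies the reversed inequalities; hence the second alternative holds over its base. -/
lemma SatisfiesAxiom.exists_of_tuple {φ : LocusFormula} {ε r : ℝ} (h : SatisfiesAxiom d φ ε r)
    (hr : 0 < r) (t : TIdx φ.n φ.k → M) (hG : ∀ i j, ⟪t i, t j⟫ = φ.gram i j)
    (hL : ∀ i, ‖t i‖ ≤ φ.L)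
    (h2 : ∃ τ > 0, ∀ v : M, ‖v‖ ≤ φ.L + 1 → ∀ i : Fin φ.n, d v ^ 2 + τ <
      ‖v - t (.inr (.inr i))‖ ^ 2 + ‖t (.inl (.inr i)) - t (.inr (.inr i))‖ ^ 2 + ε ^ 2)
    (h3 : ∀ (i : Fin φ.k) (j : Fin φ.n),
      ‖t (.inl (.inl (.inr i))) - t (.inr (.inl (.inr i)))‖ ^ 2 +
        d (t (.inr (.inl (.inr i)))) ^ 2 + ε ^ 2 <
      ‖t (.inl (.inl (.inr i))) - t (.inl (.inr j))‖ ^ 2)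
    (h4 : ∀ i j : Fin φ.n, ‖t (.inl (.inl (.inl i))) - t (.inl (.inr i))‖ - ε <
      ‖t (.inl (.inl (.inl i))) - t (.inl (.inr j))‖)
    (h5 : ∀ i : Fin φ.n, ‖t (.inl (.inl (.inl i))) - t (.inl (.inr i))‖ ^ 2 - ε ^ 2 <
      ‖t (.inl (.inl (.inl i))) - t (.inr (.inl (.inl i)))‖ ^ 2 +
        d (t (.inr (.inl (.inl i)))) ^ 2) {τ : ℝ} (hτ : 0 < τ) :
    ∃ q : XIdx φ.n φ.k ⊕ Fin φ.n → M, (∀ b, ‖q b‖ ≤ φ.L + 1) ∧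
      φ.value (Sum.elim q fun b => t (.inr b)) ≤ r + τ ∧
      (∀ i : Fin φ.n, |d (q (.inl (.inl i))) - min 1 ‖q (.inl (.inl i)) - q (.inr i)‖| ≤
        2 * (2 * √(ε * (φ.L + 2))) + τ) ∧
      (∀ i : Fin φ.k, |d (q (.inl (.inr i))) ^ 2 -
        min 1 (‖q (.inl (.inr i)) - t (.inr (.inl (.inr i)))‖ ^ 2 +
          d (t (.inr (.inl (.inr i)))) ^ 2)| ≤ 4 * (2 * √(ε * (φ.L + 2))) * φ.L + τ) := by
  have hL' : ∀ i, ‖t i‖ ≤ φ.L + 1 := fun i => (hL i).trans (by linarith)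
  rcases h (fun i => t (.inr (.inl i))) (fun i => t (.inr (.inr i))) (fun i => hL' _)
    (fun i => hL' _) with h | h
  · exfalso
    rcases h (fun i => t (.inl (.inl i))) (fun i => t (.inl (.inr i))) (fun i => hL' _)
      (fun i => hL' _) with h | h | ⟨i, j, h⟩ | ⟨i, j, -, h⟩ | ⟨i, h⟩
    · rw [concat_comp_inl_inr] at h
      have : φ.value t ≤ 0 := φ.value_le le_rfl fun i j => by simp [hG]
      linarith
    · obtain ⟨τ, hτ, h2⟩ := h2
      obtain ⟨v, hv, i, h⟩ := h τ hτ
      linarith [h2 v hv i]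
    · linarith [h3 i j]
    · linarith [h4 i j]
    · linarith [h5 i]
  · obtain ⟨x, y, hx, hy, hval, -, hd1, hd2⟩ := h τ hτ
    refine ⟨Sum.elim x y, ?_, ?_, hd1, hd2⟩
    · rintro (i | i)
      exacts [hx i, hy i]
    · convert hval using 2
      ext ((i | i) | (i | i)) <;> rfl

/-- The Gram matrix of `w + ν • g` is bounded below by `ν ^ 2`, whatever the rank of `w`. -/
lemma coercive_add_smul_orthonormal {ι : Type*} [Fintype ι] {w g : ι → M} (hg : Orthonormal ℝ g)
    (hwg : ∀ i j, ⟪w j, g i⟫ = 0) (ν : ℝ) (c : ι → ℝ) :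
    ν ^ 2 * ∑ b, c b ^ 2 ≤
      ∑ b, ∑ b', c b * c b' * ⟪w b + ν • g b, w b' + ν • g b'⟫ := by
  rw [← sq_norm_sum_smul c fun b => w b + ν • g b]
  have h1 : ∑ b, c b • (w b + ν • g b) = ∑ b, c b • w b + ν • ∑ b, c b • g b := by
    rw [Finset.smul_sum, ← Finset.sum_add_distrib]
    refine Finset.sum_congr rfl fun b _ => ?_
    rw [smul_add, smul_comm]
  have h2 : ⟪∑ b, c b • w b, ν • ∑ b, c b • g b⟫ = 0 := by
    rw [real_inner_smul_right, sum_inner]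
    simp [inner_sum, real_inner_smul_left, real_inner_smul_right, hwg]
  have h3 : ‖∑ b, c b • g b‖ ^ 2 = ∑ b, c b ^ 2 := by
    rw [← real_inner_self_eq_norm_sq, hg.inner_sum]
    simp [sq]
  rw [h1, norm_add_sq_real, h2, norm_smul, mul_pow, h3, Real.norm_eq_abs, sq_abs]
  nlinarith [sq_nonneg ‖∑ b, c b • w b‖]

/-- Let `w` be a base in a model `M` of `T_N` and let `w + A` be a tuple over it, with `A`
orthogonal to `w`. The points of `w + A` with index `inr j` play the role of zeros of `d` in an
extension: `h2` says that `d` on `M` allows such zeros, and `h3`, `h4`, `h5` say which zero, if any,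
determines the value prescribed at a point with index `inl i`. Then these values are approximately
attained in `M` by a tuple `q` with almost the same inner products over `w`. -/
theorem IsModelTN.exists_approx_tuple [CompleteSpace M] {F : LocusFormula → ℝ → ℝ}
    (hF : IsModulusChoice F) (hM : IsModelTN F d) {n k : ℕ} {w A : XIdx n k ⊕ Fin n → M}
    (hA : ∀ b, A b ≠ 0) (horth : ∀ b b', ⟪A b, w b'⟫ = 0)
    (h2 : ∀ (v : M) (i : Fin n), d v ^ 2 ≤ ‖v - w (.inr i)‖ ^ 2 + ‖A (.inr i)‖ ^ 2)
    (h3 : ∀ (i : Fin k) (j : Fin n),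
      ‖A (.inl (.inr i))‖ ^ 2 + d (w (.inl (.inr i))) ^ 2 <
        ‖(w + A) (.inl (.inr i)) - (w + A) (.inr j)‖ ^ 2)
    (h4 : ∀ i j : Fin n, ‖(w + A) (.inl (.inl i)) - (w + A) (.inr i)‖ ≤
      ‖(w + A) (.inl (.inl i)) - (w + A) (.inr j)‖)
    (h5 : ∀ i : Fin n, ‖(w + A) (.inl (.inl i)) - (w + A) (.inr i)‖ ^ 2 ≤
      ‖A (.inl (.inl i))‖ ^ 2 + d (w (.inl (.inl i))) ^ 2) {η : ℝ} (hη : 0 < η) :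
    ∃ q : XIdx n k ⊕ Fin n → M,
      (∀ b b', |⟪q b, q b'⟫ - ⟪(w + A) b, (w + A) b'⟫| ≤ η) ∧
      (∀ b b', |⟪q b, w b'⟫ - ⟪(w + A) b, w b'⟫| ≤ η) ∧
      (∀ i : Fin n, |d (q (.inl (.inl i))) -
        min 1 ‖(w + A) (.inl (.inl i)) - (w + A) (.inr i)‖| ≤ η) ∧
      (∀ i : Fin k, |d (q (.inl (.inr i))) ^ 2 -
        min 1 (‖A (.inl (.inr i))‖ ^ 2 + d (w (.inl (.inr i))) ^ 2)| ≤ η) := by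
  rcases isEmpty_or_nonempty (XIdx n k ⊕ Fin n) with hB | ⟨⟨b₀⟩⟩
  · exact ⟨w, fun b => hB.elim b, fun b => hB.elim b, fun i => hB.elim (.inr i),
      fun i => hB.elim (.inl (.inr i))⟩
  have hd := hM.isModelT0
  have hdc := hd.continuous
  -- `κ` bounds each single error. Inner products control only the squares of distances, hence the
  -- condition with the square root.
  obtain ⟨κ, hκ, hκ1, hκ2⟩ : ∃ κ : ℝ, 0 < κ ∧ 22 * κ ≤ η ∧ √(8 * κ) ≤ η / 2 := by
    refine ⟨min (η / 22) (η ^ 2 / 32), by positivity, ?_, Real.sqrt_le_iff.2 ⟨by positivity, ?_⟩⟩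
    · linarith [min_le_left (η / 22) (η ^ 2 / 32)]
    · linarith [min_le_right (η / 22) (η ^ 2 / 32)]
  obtain ⟨L, hL0, hL⟩ : ∃ L : ℕ, 0 < L ∧ ∀ b, ‖w b‖ + ‖A b‖ + 1 ≤ L := by
    have hle : ∀ b, ‖w b‖ + ‖A b‖ ≤ ∑ b, (‖w b‖ + ‖A b‖) := fun b =>
      Finset.single_le_sum (f := fun b => ‖w b‖ + ‖A b‖) (fun b _ => by positivity)
        (Finset.mem_univ b)
    refine ⟨⌈∑ b, (‖w b‖ + ‖A b‖)⌉₊ + 1, Nat.succ_pos _, fun b => ?_⟩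
    push_cast
    linarith [hle b, Nat.le_ceil (∑ b, (‖w b‖ + ‖A b‖))]
  set a := ‖A b₀‖ with ha
  have ha0 : 0 < a := norm_pos_iff.2 (hA b₀)
  -- `ε` is chosen before the base is perturbed; this is possible because the bound for the
  -- modulus depends only on `L` and `a`.
  obtain ⟨ε, hε0, hε1, hεa, hεf, hεδ, hεδL, hε3⟩ : ∃ ε : ℚ, 0 < ε ∧ ε < 1 ∧ (ε : ℝ) ≤ a ∧
      3 * (L : ℝ) ^ 2 * (ε / a) ≤ κ ∧ 2 * (2 * √(ε * (L + 2))) ≤ κ ∧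
      4 * (2 * √(ε * (L + 2))) * L ≤ κ ∧ ∀ (i : Fin k) (j : Fin n),
        ‖A (.inl (.inr i))‖ ^ 2 + d (w (.inl (.inr i))) ^ 2 + (ε : ℝ) ^ 2 <
          ‖(w + A) (.inl (.inr i)) - (w + A) (.inr j)‖ ^ 2 := by
    have hev : ∀ᶠ ε : ℝ in 𝓝[>] 0, ε < 1 ∧ ε < a ∧ 3 * (L : ℝ) ^ 2 * (ε / a) < κ ∧
        2 * (2 * √(ε * (L + 2))) < κ ∧ 4 * (2 * √(ε * (L + 2))) * L < κ ∧
        ∀ (i : Fin k) (j : Fin n),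
          ‖A (.inl (.inr i))‖ ^ 2 + d (w (.inl (.inr i))) ^ 2 + ε ^ 2 <
            ‖(w + A) (.inl (.inr i)) - (w + A) (.inr j)‖ ^ 2 := by
      refine Filter.Eventually.filter_mono nhdsWithin_le_nhds ?_
      refine (eventually_lt_nhds one_pos).and ((eventually_lt_nhds ha0).and
        (Eventually.and ?_ (Eventually.and ?_ (Eventually.and ?_ ?_))))
      · refine ContinuousAt.eventually_lt (by fun_prop) continuousAt_const (by simpa using hκ)
      · refine ContinuousAt.eventually_lt (by fun_prop) continuousAt_const (by simpa using hκ)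
      · refine ContinuousAt.eventually_lt (by fun_prop) continuousAt_const (by simpa using hκ)
      · simp only [eventually_all]
        intro i j
        exact ContinuousAt.eventually_lt (by fun_prop) continuousAt_const (by simpa using h3 i j)
    obtain ⟨c, hc0, hc⟩ := mem_nhdsGT_iff_exists_Ioo_subset.1 hev
    obtain ⟨ε, hε0, hεc⟩ := exists_rat_btwn (show (0 : ℝ) < c from hc0)
    obtain ⟨k1, k2, k3, k4, k5, k6⟩ := hc ⟨hε0, hεc⟩
    exact ⟨ε, by exact_mod_cast hε0, by exact_mod_cast k1, k2.le, k3.le, k4.le, k5.le, k6⟩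
  have hε0' : (0 : ℝ) < ε := by exact_mod_cast hε0
  have hε1' : (ε : ℝ) < 1 := by exact_mod_cast hε1
  -- Adding `ν • g`, with `g` orthonormal and orthogonal to everything else, makes the base linearly
  -- independent, so that the locus has a modulus. The inequalities hold strictly with margin
  -- depending on `ε`, hence they survive for small `ν`.
  obtain ⟨g, hg, hgo⟩ := exists_orthonormal_orthogonal_range (ι := XIdx n k ⊕ Fin n)
    hM.infinite_dimensional (Sum.elim w A)
  have hwg : ∀ i j, ⟪w j, g i⟫ = 0 := fun i j => hgo i (.inl j)
  have hAg : ∀ i j, ⟪A j, g i⟫ = 0 := fun i j => hgo i (.inr j)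
  let T : ℝ → TIdx n k → M := fun ν =>
    Sum.elim (fun b => w b + ν • g b + A b) (fun b => w b + ν • g b)
  have hT0 : T 0 = Sum.elim (w + A) w := by
    ext (b | b) <;> simp [T]
  have hTc : ∀ s, Continuous fun ν => T ν s := by
    rintro (b | b)
    · change Continuous fun ν : ℝ => w b + ν • g b + A b
      fun_prop
    · change Continuous fun ν : ℝ => w b + ν • g b
      fun_prop
  have hTsub : ∀ ν b, T ν (.inl b) - T ν (.inr b) = A b := fun ν b => add_sub_cancel_left _ _
  have hlt : ∀ {f₁ f₂ : ℝ → ℝ}, Continuous f₁ → Continuous f₂ → f₁ 0 < f₂ 0 →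
      ∀ᶠ ν in 𝓝[>] 0, f₁ ν < f₂ ν := fun c₁ c₂ h =>
    (ContinuousAt.eventually_lt c₁.continuousAt c₂.continuousAt h).filter_mono nhdsWithin_le_nhds
  have hclose : ∀ {f : ℝ → ℝ}, Continuous f → ∀ᶠ ν in 𝓝[>] 0, |f ν - f 0| < κ := fun hf =>
    hlt ((hf.sub continuous_const).abs) continuous_const (by simpa using hκ)
  have hev : ∀ᶠ ν : ℝ in 𝓝[>] 0, 0 < ν ∧ ν < 1 ∧ ν * (4 * L + 2) < (ε : ℝ) ^ 2 / 2 ∧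
      ν * (L + 1) < κ ∧
      (∀ (i : Fin k) (j : Fin n),
        ‖A (.inl (.inr i))‖ ^ 2 + d (T ν (.inr (.inl (.inr i)))) ^ 2 + (ε : ℝ) ^ 2 <
          ‖T ν (.inl (.inl (.inr i))) - T ν (.inl (.inr j))‖ ^ 2) ∧
      (∀ i j : Fin n, ‖T ν (.inl (.inl (.inl i))) - T ν (.inl (.inr i))‖ - ε <
          ‖T ν (.inl (.inl (.inl i))) - T ν (.inl (.inr j))‖) ∧
      (∀ i : Fin n, ‖T ν (.inl (.inl (.inl i))) - T ν (.inl (.inr i))‖ ^ 2 - (ε : ℝ) ^ 2 <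
        ‖A (.inl (.inl i))‖ ^ 2 + d (T ν (.inr (.inl (.inl i)))) ^ 2) ∧
      (∀ s s', |⟪T ν s, T ν s'⟫ - ⟪T 0 s, T 0 s'⟫| < κ) ∧
      (∀ i : Fin n, |‖T ν (.inl (.inl (.inl i))) - T ν (.inl (.inr i))‖ -
        ‖T 0 (.inl (.inl (.inl i))) - T 0 (.inl (.inr i))‖| < κ) ∧
      (∀ i : Fin k, |d (T ν (.inr (.inl (.inr i)))) ^ 2 -
        d (T 0 (.inr (.inl (.inr i)))) ^ 2| < κ) := by
    simp only [eventually_and, eventually_all]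
    refine ⟨self_mem_nhdsWithin, hlt continuous_id continuous_const one_pos,
      hlt (by fun_prop) continuous_const (by simpa using by positivity),
      hlt (by fun_prop) continuous_const (by simpa using hκ), fun i j => ?_, fun i j => ?_,
      fun i => ?_, fun s s' => ?_, fun i => ?_, fun i => ?_⟩
    · refine hlt (by fun_prop) (by fun_prop) ?_
      rw [hT0]
      exact hε3 i j
    · refine hlt (by fun_prop) (by fun_prop) ?_
      rw [hT0]
      exact (sub_lt_self _ hε0').trans_le (h4 i j)
    · refine hlt (by fun_prop) (by fun_prop) ?_
      rw [hT0]
      exact (sub_lt_self _ (by positivity)).trans_le (h5 i)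
    · exact hclose ((hTc s).inner (hTc s'))
    · exact hclose (((hTc _).sub (hTc _)).norm)
    · exact hclose ((hdc.comp (hTc _)).pow 2)
  obtain ⟨ν, hν0, hν1, hν2, hνκ, n3, n4, n5, n6, n7, n8⟩ := hev.exists
  have hνg : ∀ b, ‖ν • g b‖ = ν := fun b => by
    rw [norm_smul, hg.1, mul_one, Real.norm_of_nonneg hν0.le]
  have hTL : ∀ s, ‖T ν s‖ ≤ L := by
    rintro (b | b)
    · calc ‖w b + ν • g b + A b‖ ≤ ‖w b‖ + ‖ν • g b‖ + ‖A b‖ := norm_add₃_le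
        _ ≤ L := by rw [hνg]; linarith [hL b]
    · calc ‖w b + ν • g b‖ ≤ ‖w b‖ + ‖ν • g b‖ := norm_add_le _ _
        _ ≤ L := by rw [hνg]; linarith [hL b, norm_nonneg (A b)]
  have m2 : ∀ v : M, ‖v‖ ≤ L + 1 → ∀ i : Fin n, d v ^ 2 + (ε : ℝ) ^ 2 / 4 <
      ‖v - T ν (.inr (.inr i))‖ ^ 2 + ‖T ν (.inl (.inr i)) - T ν (.inr (.inr i))‖ ^ 2 +
        (ε : ℝ) ^ 2 := by
    intro v hv i
    have e1 : T ν (.inr (.inr i)) = w (.inr i) + ν • g (.inr i) := rfl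
    rw [hTsub ν (.inr i), e1, ← sub_sub, norm_sub_sq_real, real_inner_smul_right]
    have e2 : ⟪v - w (.inr i), g (.inr i)⟫ ≤ 2 * L + 1 := by
      refine (real_inner_le_norm _ _).trans ?_
      rw [hg.1, mul_one]
      refine (norm_sub_le _ _).trans ?_
      linarith [hL (.inr i), norm_nonneg (A (.inr i))]
    have e3 := mul_le_mul_of_nonneg_left e2 hν0.le
    nlinarith [h2 v i, sq_nonneg ‖ν • g (.inr i)‖, hν2, e3, sq_nonneg (ε : ℝ)]
  have m3 : ∀ (i : Fin k) (j : Fin n),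
      ‖T ν (.inl (.inl (.inr i))) - T ν (.inr (.inl (.inr i)))‖ ^ 2 +
        d (T ν (.inr (.inl (.inr i)))) ^ 2 + (ε : ℝ) ^ 2 <
      ‖T ν (.inl (.inl (.inr i))) - T ν (.inl (.inr j))‖ ^ 2 := fun i j => by
    rw [hTsub ν (.inl (.inr i))]
    exact n3 i j
  have m5 : ∀ i : Fin n, ‖T ν (.inl (.inl (.inl i))) - T ν (.inl (.inr i))‖ ^ 2 - (ε : ℝ) ^ 2 <
      ‖T ν (.inl (.inl (.inl i))) - T ν (.inr (.inl (.inl i)))‖ ^ 2 +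
        d (T ν (.inr (.inl (.inl i)))) ^ 2 := fun i => by
    rw [hTsub ν (.inl (.inl i))]
    exact n5 i
  let φ : LocusFormula := LocusFormula.ofTuple (T ν) L hL0 hTL
    (fun b hb => hA b (by rw [← hTsub ν b, hb, sub_self]))
    (fun b b' => by
      rw [hTsub]
      change ⟪A b, w b' + ν • g b'⟫ = 0
      rw [inner_add_right, real_inner_smul_right, horth, hAg, mul_zero, zero_add])
  have hmod : IsModulus φ (F φ) :=
    hF φ (φ.exists_isModulus (pow_pos hν0 2) (coercive_add_smul_orthonormal hg hwg ν))
  have hr : F φ ε ≤ κ := by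
    refine (hmod.le_linear (i := .inl b₀) (j := .inr b₀) ha0 ?_ ⟨hε0', hε1'⟩ hεa).trans hεf
    rw [ha, ← hTsub ν b₀]
    exact (sq_norm_sub_eq_gram _ _).symm
  obtain ⟨q, hqL, hqv, hq1, hq2⟩ := (hM.scheme φ ⟨_, hmod⟩ ε hε0 hε1).exists_of_tuple
    (hmod.pos _ ⟨hε0', hε1'⟩) (T ν) (fun _ _ => rfl) hTL
    ⟨(ε : ℝ) ^ 2 / 4, by positivity, m2⟩ m3 n4 m5 hκ
  have hval := hqv.trans (add_le_add_left hr κ)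
  have hgram : ∀ s s', |⟪(Sum.elim q fun b => T ν (.inr b) : TIdx n k → M) s,
      (Sum.elim q fun b => T ν (.inr b) : TIdx n k → M) s'⟫ - ⟪T ν s, T ν s'⟫| ≤ κ + κ :=
    fun s s' => (φ.abs_inner_sub_gram_le _ s s').trans hval
  have hdist : ∀ s s', |‖(Sum.elim q fun b => T ν (.inr b) : TIdx n k → M) s -
      (Sum.elim q fun b => T ν (.inr b) : TIdx n k → M) s'‖ ^ 2 - ‖T ν s - T ν s'‖ ^ 2| ≤
      8 * κ := by
    intro s s'
    have := φ.abs_sq_norm_sub_sub_le (Sum.elim q fun b => T ν (.inr b)) s s'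
    rw [sq_norm_sub_eq_gram (T ν s)]
    exact (this.trans (mul_le_mul_of_nonneg_left hval (by norm_num))).trans_eq (by ring)
  refine ⟨q, fun b b' => ?_, fun b b' => ?_, fun i => ?_, fun i => ?_⟩
  · have k1 := hgram (.inl b) (.inl b')
    have k2 := n6 (.inl b) (.inl b')
    rw [hT0] at k2
    refine (abs_sub_le _ _ _).trans ((add_le_add k1 k2.le).trans ?_)
    linarith
  · have k1 := hgram (.inl b) (.inr b')
    have k2 := n6 (.inl b) (.inr b')
    rw [hT0] at k2
    have k3 : |⟪q b, w b'⟫ - ⟪q b, T ν (.inr b')⟫| ≤ κ := by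
      rw [← inner_sub_right, show w b' - T ν (.inr b') = -(ν • g b') by simp [T]]
      refine (abs_real_inner_le_norm _ _).trans ?_
      rw [norm_neg, hνg, mul_comm]
      exact (mul_le_mul_of_nonneg_left (hqL b) hν0.le).trans hνκ.le
    refine (abs_sub_le _ _ _).trans
      ((add_le_add k3 ((abs_sub_le _ _ _).trans (add_le_add k1 k2.le))).trans ?_)
    linarith
  · have k1 := (hq1 i).trans (add_le_add_left hεδ κ)
    have k2 := (abs_sub_le_sqrt_of_abs_sq_sub_le (norm_nonneg _) (norm_nonneg _)
      (hdist (.inl (.inl (.inl i))) (.inl (.inr i)))).trans hκ2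
    have k3 := n7 i
    rw [hT0] at k3
    have k4 := (abs_sub_le _ _ _).trans (add_le_add k2 k3.le)
    have k5 := (abs_min_sub_min_le_max 1 _ 1 _).trans
      (max_le (by rw [sub_self, abs_zero]; positivity) k4)
    refine (abs_sub_le _ _ _).trans ((add_le_add k1 k5).trans ?_)
    linarith
  · have k1 := (hq2 i).trans (add_le_add_left hεδL κ)
    have k2 := hdist (.inl (.inl (.inr i))) (.inr (.inl (.inr i)))
    rw [hTsub ν (.inl (.inr i))] at k2
    have k3 := n8 i
    rw [hT0] at k3
    have k4 : |(‖q (.inl (.inr i)) - T ν (.inr (.inl (.inr i)))‖ ^ 2 +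
        d (T ν (.inr (.inl (.inr i)))) ^ 2) -
        (‖A (.inl (.inr i))‖ ^ 2 + d (w (.inl (.inr i))) ^ 2)| ≤ 8 * κ + κ := by
      rw [add_sub_add_comm]
      exact (abs_add_le _ _).trans (add_le_add k2 k3.le)
    have k5 := (abs_min_sub_min_le_max 1 _ 1 _).trans
      (max_le (by rw [sub_self, abs_zero]; positivity) k4)
    refine (abs_sub_le _ _ _).trans ((add_le_add k1 k5).trans ?_)
    linarith

end Transfer

/-! ### Black points and extensions of models of `T_0` -/

section Extension

/-- In a model of `T_0` the black points, that is the zeros of `d`, exist exactly and not only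
approximately: by completeness, the points given by the first axiom can be corrected
step by step. -/
lemma IsModelT0.exists_eq_zero_norm_sub_lt {H : Type*} [NormedAddCommGroup H]
    [InnerProductSpace ℝ H] [CompleteSpace H] {d : H → ℝ} (hd : IsModelT0 d) {x : H}
    (hx : d x < 1) {ε : ℝ} (hε : 0 < ε) : ∃ y, d y = 0 ∧ ‖x - y‖ < d x + ε := by
  obtain ⟨τ, hτ, hτε, hτ1⟩ : ∃ τ : ℝ, 0 < τ ∧ 8 * τ ≤ ε ∧ τ ≤ 1 / 2 :=
    ⟨min (ε / 8) (1 / 2), by positivity, by linarith [min_le_left (ε / 8) (1 / 2)],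
      min_le_right _ _⟩
  have hstep : ∀ (n : ℕ) (x : H), ∃ y, d x < 1 → d y ≤ τ / 2 ^ n ∧ ‖x - y‖ ≤ d x + τ / 2 ^ n := by
    intro n x
    by_cases hx : d x < 1
    · obtain ⟨y, hy⟩ := (hd.approx_witness x).resolve_left hx.not_ge (τ / 2 ^ n) (by positivity)
      have h1 := abs_le.1 ((le_max_left _ _).trans hy)
      exact ⟨y, fun _ => ⟨(le_max_right _ _).trans hy, by linarith [h1.1]⟩⟩
    · exact ⟨x, fun h => absurd h hx⟩
  choose g hg using hstep
  let s : ℕ → H := fun n => Nat.rec (g 0 x) (fun n y => g (n + 1) y) n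
  have hs : ∀ n, s (n + 1) = g (n + 1) (s n) := fun n => rfl
  have hτn : ∀ n : ℕ, τ / 2 ^ n < 1 := fun n =>
    (div_le_self hτ.le (one_le_pow₀ one_le_two)).trans_lt (by linarith)
  have hds : ∀ n, d (s n) ≤ τ / 2 ^ n := by
    intro n
    induction n with
    | zero => exact (hg 0 x hx).1
    | succ n ih => exact (hg (n + 1) (s n) (ih.trans_lt (hτn n))).1
  have hdist : ∀ n, dist (s n) (s (n + 1)) ≤ 4 * τ / 2 / 2 ^ n := by
    intro n
    rw [dist_eq_norm, hs]
    refine (hg (n + 1) (s n) ((hds n).trans_lt (hτn n))).2.trans ?_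
    have h1 : τ / 2 ^ (n + 1) ≤ τ / 2 ^ n := by
      gcongr
      · norm_num
      · exact n.le_succ
    calc _ ≤ τ / 2 ^ n + τ / 2 ^ n := add_le_add (hds n) h1
      _ = _ := by ring
  obtain ⟨y, hy⟩ := cauchySeq_tendsto_of_complete (cauchySeq_of_le_geometric_two hdist)
  have h0 : d y = 0 := by
    refine le_antisymm ?_ (hd.nonneg y)
    have h1 : Tendsto (fun n : ℕ => τ / 2 ^ n) atTop (𝓝 0) := by
      simpa [div_eq_mul_inv] using
        (tendsto_pow_atTop_nhds_zero_of_lt_one (r := (1 / 2 : ℝ)) (by norm_num)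
          (by norm_num)).const_mul τ
    exact le_of_tendsto_of_tendsto' ((hd.continuous.tendsto y).comp hy) h1 hds
  refine ⟨y, h0, ?_⟩
  have h1 : ‖x - s 0‖ ≤ d x + τ / 2 ^ 0 := (hg 0 x hx).2
  have h2 := dist_le_of_le_geometric_two_of_tendsto₀ hdist hy
  rw [dist_eq_norm] at h2
  have h3 := norm_sub_le_norm_sub_add_norm_sub x (s 0) y
  rw [pow_zero, div_one] at h1
  linarith

variable {M : Type u} [NormedAddCommGroup M] [InnerProductSpace ℝ M]
  {H : Type v} [NormedAddCommGroup H] [InnerProductSpace ℝ H] {i : M →ₗᵢ[ℝ] H}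

variable (i) in
/-- The orthogonal projection of an extension `H` on the complete subspace `M`, with values in `M`
itself. The other lemmas use only the orthogonality stated here. -/
lemma exists_proj [CompleteSpace M] [CompleteSpace H] :
    ∃ π : H → M, ∀ x m, ⟪x - i (π x), i m⟫ = 0 := by
  refine ⟨i.toContinuousLinearMap.adjoint, fun x m => ?_⟩
  rw [inner_sub_left, i.inner_map_map, ContinuousLinearMap.adjoint_inner_left]
  exact sub_self _

variable {π : H → M}

lemma sq_norm_sub_map_eq (hπ : ∀ x m, ⟪x - i (π x), i m⟫ = 0) (x : H) (m : M) :
    ‖x - i m‖ ^ 2 = ‖x - i (π x)‖ ^ 2 + ‖π x - m‖ ^ 2 := by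
  rw [show x - i m = (x - i (π x)) + i (π x - m) by rw [map_sub]; abel, norm_add_sq_real, hπ,
    i.norm_map]
  ring

lemma proj_eq (hπ : ∀ x m, ⟪x - i (π x), i m⟫ = 0) {x : H} {m : M}
    (h : ∀ m', ⟪x - i m, i m'⟫ = 0) : π x = m := by
  have h1 : ⟪i (π x - m), i (π x - m)⟫ = 0 := by
    have := h (π x - m)
    rwa [show x - i m = (x - i (π x)) + i (π x - m) by rw [map_sub]; abel, inner_add_left, hπ,
      zero_add] at this
  rw [inner_self_eq_zero, ← norm_eq_zero, i.norm_map, norm_eq_zero, sub_eq_zero] at h1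
  exact h1

variable [CompleteSpace M] [CompleteSpace H] {d : M → ℝ} {dH : H → ℝ}

/-- The black points of `M` near `π x` bound `d x` from above, by the Pythagorean theorem. -/
lemma IsModelT0.sq_le_sq_norm_sub_proj_add (hd : IsModelT0 d) (hdH : IsModelT0 dH)
    (hi : ∀ w, dH (i w) = d w) (hπ : ∀ x m, ⟪x - i (π x), i m⟫ = 0) (x : H) :
    dH x ^ 2 ≤ ‖x - i (π x)‖ ^ 2 + d (π x) ^ 2 := by
  rcases lt_or_ge (d (π x)) 1 with h1 | h1
  · have hε : ∀ ε > 0, dH x ^ 2 ≤ ‖x - i (π x)‖ ^ 2 + (d (π x) + ε) ^ 2 := by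
      intro ε hε
      obtain ⟨y, hy, hxy⟩ := hd.exists_eq_zero_norm_sub_lt h1 hε
      have h2 := hdH.lipschitz (i y) x
      rw [hi, hy, norm_sub_rev] at h2
      calc dH x ^ 2 ≤ ‖x - i y‖ ^ 2 := pow_le_pow_left₀ (hdH.nonneg x) (by linarith) 2
        _ = ‖x - i (π x)‖ ^ 2 + ‖π x - y‖ ^ 2 := sq_norm_sub_map_eq hπ x y
        _ ≤ _ := by gcongr
    have hc : Tendsto (fun ε => ‖x - i (π x)‖ ^ 2 + (d (π x) + ε) ^ 2) (𝓝[>] 0)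
        (𝓝 (‖x - i (π x)‖ ^ 2 + (d (π x) + 0) ^ 2)) :=
      (Continuous.tendsto (by fun_prop) 0).mono_left nhdsWithin_le_nhds
    rw [add_zero] at hc
    exact ge_of_tendsto hc (eventually_mem_nhdsWithin.mono hε)
  · have h2 : dH x ^ 2 ≤ 1 := pow_le_one₀ (hdH.nonneg x) (hdH.le_one x)
    have h3 : 1 ≤ d (π x) ^ 2 := one_le_pow₀ h1
    linarith [sq_nonneg ‖x - i (π x)‖]

/-- Given finitely many points `P s` of an extension `H` of `M`, there is a finite set `Y g` of
black points of `H` outside `M` such that `d (P s)` is determined either by a nearest point of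
`Y`, or, if `Y` is too far away, by the black points of `M`. -/
lemma IsModelT0.exists_black_points {S : Type*} [Finite S] (hd : IsModelT0 d) (hdH : IsModelT0 dH)
    (hi : ∀ w, dH (i w) = d w) (hπ : ∀ x m, ⟪x - i (π x), i m⟫ = 0) (P : S → H) {η : ℝ}
    (hη : 0 < η) : ∃ (G : Set S) (Y : G → H), (∀ g, dH (Y g) = 0 ∧ Y g ∉ Set.range i) ∧
      ∀ s, (∃ g, (∀ g', ‖P s - Y g‖ ≤ ‖P s - Y g'‖) ∧
          ‖P s - Y g‖ ^ 2 ≤ ‖P s - i (π (P s))‖ ^ 2 + d (π (P s)) ^ 2 ∧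
          |dH (P s) - min 1 ‖P s - Y g‖| ≤ η) ∨
        ((∀ g, ‖P s - i (π (P s))‖ ^ 2 + d (π (P s)) ^ 2 < ‖P s - Y g‖ ^ 2) ∧
          dH (P s) ^ 2 = min 1 (‖P s - i (π (P s))‖ ^ 2 + d (π (P s)) ^ 2)) := by
  set R : S → ℝ := fun s => ‖P s - i (π (P s))‖ ^ 2 + d (π (P s)) ^ 2 with hR
  let G : Set S := {s | dH (P s) < 1 ∧ dH (P s) ^ 2 < R s}
  have hex : ∀ g : G, ∃ y, dH y = 0 ∧ ‖P g - y‖ ≤ dH (P g) + η ∧ ‖P g - y‖ ^ 2 < R g := by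
    rintro ⟨s, h1, h2⟩
    have h3 : dH (P s) < √(R s) := Real.lt_sqrt_of_sq_lt h2
    obtain ⟨y, hy0, hy⟩ := hdH.exists_eq_zero_norm_sub_lt h1 (lt_min hη (sub_pos.2 h3))
    refine ⟨y, hy0, hy.le.trans (by gcongr; exact min_le_left _ _), ?_⟩
    rw [← Real.lt_sqrt (norm_nonneg _)]
    linarith [min_le_right η (√(R s) - dH (P s))]
  choose Y hY0 hYη hYR using hex
  have hle : ∀ s g, dH (P s) ≤ ‖P s - Y g‖ := by
    intro s g
    have := hdH.lipschitz (Y g) (P s)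
    rw [hY0, norm_sub_rev] at this
    linarith
  refine ⟨G, Y, fun g => ⟨hY0 g, ?_⟩, fun s => ?_⟩
  · -- A black point `m` of `M` satisfies `d (π (P g)) ≤ ‖π (P g) - m‖`, so it is not closer to
    -- `P g` than `√(R g)`.
    rintro ⟨m, hm⟩
    have h1 := hYR g
    have h2 := hY0 g
    rw [← hm, hi] at h2
    rw [← hm, sq_norm_sub_map_eq hπ] at h1
    have h3 := hd.lipschitz m (π (P g))
    rw [h2, norm_sub_rev] at h3
    have h4 : d (π (P g)) ^ 2 ≤ ‖π (P g) - m‖ ^ 2 :=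
      pow_le_pow_left₀ (hd.nonneg _) (by linarith) 2
    simp only [hR] at h1
    linarith
  by_cases hs : ∃ g, ‖P s - Y g‖ ^ 2 ≤ R s
  · left
    obtain ⟨g₀, hg₀⟩ := hs
    have : Nonempty G := ⟨g₀⟩
    obtain ⟨g, hg⟩ := Finite.exists_min fun g => ‖P s - Y g‖
    have hgR : ‖P s - Y g‖ ^ 2 ≤ R s := (pow_le_pow_left₀ (norm_nonneg _) (hg g₀) 2).trans hg₀
    refine ⟨g, hg, hgR, ?_⟩
    have h1 : dH (P s) ≤ min 1 ‖P s - Y g‖ := le_min (hdH.le_one _) (hle s g)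
    have h2 : min 1 ‖P s - Y g‖ ≤ dH (P s) + η := by
      by_cases hsG : s ∈ G
      · exact (min_le_right _ _).trans ((hg ⟨s, hsG⟩).trans (hYη ⟨s, hsG⟩))
      · rcases not_and_or.1 hsG with h | h
        · exact (min_le_left _ _).trans (by linarith)
        · refine (min_le_right _ _).trans (le_trans ?_ (le_add_of_nonneg_right hη.le))
          exact le_of_sq_le_sq (hgR.trans (not_lt.1 h)) (hdH.nonneg _)
    rw [_root_.abs_le]
    constructor <;> linarith
  · right
    push Not at hs
    refine ⟨hs, ?_⟩
    have hsG : s ∉ G := fun h => (hs ⟨s, h⟩).not_gt (hYR ⟨s, h⟩)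
    have h1 : dH (P s) ^ 2 ≤ R s := hd.sq_le_sq_norm_sub_proj_add hdH hi hπ (P s)
    have h2 : dH (P s) ^ 2 ≤ 1 := pow_le_one₀ (hdH.nonneg _) (hdH.le_one _)
    refine le_antisymm (le_min h2 h1) ?_
    rcases not_and_or.1 hsG with h | h
    · exact (min_le_left _ _).trans (one_le_pow₀ (not_lt.1 h))
    · exact (min_le_right _ _).trans (not_lt.1 h)

/-- Finitely many points of an extension `H` that lie outside `M` can be imitated in `M`. -/
lemma IsModelTN.exists_approx_of_notMem_range {F : LocusFormula → ℝ → ℝ}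
    (hF : IsModulusChoice F) (hM : IsModelTN F d) (hdH : IsModelT0 dH)
    (hi : ∀ w, dH (i w) = d w) (hπ : ∀ x m, ⟪x - i (π x), i m⟫ = 0) {S : Type*} [Finite S]
    (P : S → H) (hP : ∀ s, P s ∉ Set.range i) {η : ℝ} (hη : 0 < η) :
    ∃ q : S → M, (∀ s t, |⟪q s, q t⟫ - ⟪P s, P t⟫| ≤ η) ∧
      (∀ s t, |⟪q s, π (P t)⟫ - ⟪π (P s), π (P t)⟫| ≤ η) ∧
      ∀ s, |d (q s) - dH (P s)| ≤ η := by
  classical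
  have hd := hM.isModelT0
  obtain ⟨κ, hκ, hκ1, hκ2, hκ3⟩ : ∃ κ : ℝ, 0 < κ ∧ κ ≤ η ∧ 2 * κ ≤ η ∧ √κ ≤ η := by
    refine ⟨min (η / 2) (η ^ 2), by positivity, ?_, ?_, Real.sqrt_le_iff.2 ⟨hη.le, min_le_right _ _⟩⟩
    · linarith [min_le_left (η / 2) (η ^ 2)]
    · linarith [min_le_left (η / 2) (η ^ 2)]
  obtain ⟨G, Y, hY, hS⟩ := hd.exists_black_points hdH hi hπ P hκ
  -- The points with a nearest black point in `Y` become the `x i` with `i ≤ n`, the others those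
  -- with `n < i`.
  let near : S → Prop := fun s => ∃ g, (∀ g', ‖P s - Y g‖ ≤ ‖P s - Y g'‖) ∧
    ‖P s - Y g‖ ^ 2 ≤ ‖P s - i (π (P s))‖ ^ 2 + d (π (P s)) ^ 2 ∧
    |dH (P s) - min 1 ‖P s - Y g‖| ≤ κ
  obtain ⟨n, ⟨e₁⟩⟩ := Finite.exists_equiv_fin {s // near s}
  obtain ⟨k, ⟨e₂⟩⟩ := Finite.exists_equiv_fin {s // ¬ near s}
  let σ : XIdx n k ≃ S := (Equiv.sumCongr e₁.symm e₂.symm).trans (Equiv.sumCompl near)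
  have hnear : ∀ j : Fin n, near (σ (.inl j)) := fun j => (e₁.symm j).2
  have hfar : ∀ j : Fin k, ¬ near (σ (.inr j)) := fun j => (e₂.symm j).2
  choose g hg1 hg2 hg3 using hnear
  have hfar' := fun j => (hS (σ (.inr j))).resolve_left (hfar j)
  let V : XIdx n k ⊕ Fin n → H := Sum.elim (fun b => P (σ b)) (fun j => Y (g j))
  have hV : ∀ b, V b ∉ Set.range i := by
    rintro (b | j)
    exacts [hP _, (hY _).2]
  let w : XIdx n k ⊕ Fin n → M := fun b => π (V b)
  have : FiniteDimensional ℝ (Submodule.span ℝ (Set.range w)) :=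
    FiniteDimensional.span_of_finite ℝ (Set.finite_range w)
  obtain ⟨A, hAG, hAK⟩ := exists_mem_orthogonal_gram_eq hM.infinite_dimensional
    (Submodule.span ℝ (Set.range w)) (fun b => V b - i (w b))
  have horth : ∀ b b', ⟪A b, w b'⟫ = 0 := fun b b' =>
    (Submodule.mem_orthogonal' _ _).1 (hAK b) _ (Submodule.subset_span ⟨b', rfl⟩)
  have hAn : ∀ b, ‖A b‖ = ‖V b - i (w b)‖ := fun b => by
    rw [norm_eq_sqrt_real_inner, hAG, ← norm_eq_sqrt_real_inner]
  have hgram : ∀ b b', ⟪(w + A) b, (w + A) b'⟫ = ⟪V b, V b'⟫ := by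
    intro b b'
    have h1 : V b = i (w b) + (V b - i (w b)) := by abel
    have h2 : V b' = i (w b') + (V b' - i (w b')) := by abel
    have h3 : ⟪w b, A b'⟫ = 0 := by rw [real_inner_comm, horth]
    have h4 : ⟪i (w b), V b' - i (w b')⟫ = 0 := by rw [real_inner_comm]; exact hπ _ _
    have h5 : ⟪V b - i (w b), i (w b')⟫ = 0 := hπ _ _
    rw [h1, h2]
    simp only [Pi.add_apply, inner_add_left, inner_add_right]
    rw [horth, h3, h4, h5, hAG, i.inner_map_map]
  have hdist : ∀ b b', ‖(w + A) b - (w + A) b'‖ = ‖V b - V b'‖ := by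
    intro b b'
    rw [← sq_eq_sq₀ (norm_nonneg _) (norm_nonneg _), sq_norm_sub_eq_gram, sq_norm_sub_eq_gram,
      hgram, hgram, hgram]
  obtain ⟨q, hq1, hq2, hq3, hq4⟩ := hM.exists_approx_tuple hF (w := w) (A := A)
    (fun b hb => hV b ⟨w b, by
      rw [eq_comm, ← sub_eq_zero, ← norm_eq_zero, ← hAn, hb, norm_zero]⟩) horth
    (fun x j => by
      have h1 := hdH.lipschitz (V (.inr j)) (i x)
      rw [hi, show dH (V (.inr j)) = 0 from (hY _).1, norm_sub_rev] at h1
      rw [hAn, norm_sub_rev, add_comm, ← sq_norm_sub_map_eq hπ, norm_sub_rev]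
      exact pow_le_pow_left₀ (hd.nonneg x) (by linarith) 2)
    (fun j j' => by rw [hAn, hdist]; exact (hfar' j).1 _)
    (fun j j' => by rw [hdist, hdist]; exact hg1 j _)
    (fun j => by rw [hAn, hdist]; exact hg2 j) hκ
  refine ⟨fun s => q (.inl (σ.symm s)), fun s t => ?_, fun s t => ?_, fun s => ?_⟩
  · obtain ⟨b, rfl⟩ := σ.surjective s
    obtain ⟨b', rfl⟩ := σ.surjective t
    have := hq1 (.inl b) (.inl b')
    rw [hgram] at this
    simp only [σ.symm_apply_apply]
    exact this.trans hκ1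
  · obtain ⟨b, rfl⟩ := σ.surjective s
    obtain ⟨b', rfl⟩ := σ.surjective t
    have := hq2 (.inl b) (.inl b')
    rw [Pi.add_apply, inner_add_left, horth, add_zero] at this
    simp only [σ.symm_apply_apply]
    exact this.trans hκ1
  · obtain ⟨b | b, rfl⟩ := σ.surjective s
    · have h1 := hq3 b
      rw [hdist] at h1
      have h2 := hg3 b
      rw [abs_sub_comm] at h2
      simp only [σ.symm_apply_apply]
      exact (abs_sub_le _ _ _).trans ((add_le_add h1 h2).trans (by linarith))
    · have h1 := hq4 b
      rw [hAn] at h1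
      have h2 : |d (q (.inl (.inr b))) ^ 2 - dH (P (σ (.inr b))) ^ 2| ≤ κ := by
        rw [(hfar' b).2]
        exact h1
      simp only [σ.symm_apply_apply]
      exact (abs_sub_le_sqrt_of_abs_sq_sub_le (hd.nonneg _) (hdH.nonneg _) h2).trans hκ3

/-- Finitely many points of an extension `H` can be imitated in `M`; the copies of the points
of `M` are these points themselves. -/
theorem IsModelTN.exists_approx {F : LocusFormula → ℝ → ℝ}
    (hF : IsModulusChoice F) (hM : IsModelTN F d) (hdH : IsModelT0 dH)
    (hi : ∀ w, dH (i w) = d w) {S : Type*} [Finite S] (p : S → H) {η : ℝ} (hη : 0 < η) :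
    ∃ q : S → M, (∀ s t, |⟪q s, q t⟫ - ⟪p s, p t⟫| ≤ η) ∧ (∀ s, |d (q s) - dH (p s)| ≤ η) ∧
      ∀ s m, p s = i m → q s = m := by
  classical
  obtain ⟨π, hπ⟩ := exists_proj i
  by_cases hall : ∀ s, p s ∈ Set.range i
  · choose q hq using hall
    refine ⟨q, fun s t => ?_, fun s => ?_, fun s m h => i.injective (by rw [hq, h])⟩
    · rw [← hq s, ← hq t, i.inner_map_map, sub_self, abs_zero]
      exact hη.le
    · rw [← hq s, hi, sub_self, abs_zero]
      exact hη.le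
  push Not at hall
  obtain ⟨s₀, hs₀⟩ := hall
  set v := p s₀ - i (π (p s₀)) with hv
  have hvi : ∀ m, ⟪v, i m⟫ = 0 := hπ (p s₀)
  have hvr : v ∉ Set.range i := by
    rintro ⟨m, hm⟩
    have h1 := hvi m
    rw [hm, inner_self_eq_zero, hv, sub_eq_zero] at h1
    exact hs₀ ⟨_, h1.symm⟩
  -- A point of `M` is moved out of `M` by the vector `v` orthogonal to `M`; its projection
  -- remains the original point.
  let P : S → H := fun s => if p s ∈ Set.range i then p s + v else p s
  have hP1 : ∀ s, p s ∉ Set.range i → P s = p s := fun s h => if_neg h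
  have hP2 : ∀ s m, p s = i m → P s = i m + v := fun s m h => by
    rw [← h]
    exact if_pos ⟨m, h.symm⟩
  have hπP : ∀ s m, p s = i m → π (P s) = m := fun s m h =>
    proj_eq hπ fun m' => by rw [hP2 s m h, add_sub_cancel_left, hvi]
  have hPr : ∀ s, P s ∉ Set.range i := by
    intro s
    by_cases hs : p s ∈ Set.range i
    · obtain ⟨m, hm⟩ := hs
      rw [hP2 s m hm.symm]
      rintro ⟨m', hm'⟩
      exact hvr ⟨m' - m, by rw [map_sub, hm', add_sub_cancel_left]⟩
    · rwa [hP1 s hs]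
  obtain ⟨q, hq1, hq2, hq3⟩ := hM.exists_approx_of_notMem_range hF hdH hi hπ P hPr hη
  let q' : S → M := fun s => if p s ∈ Set.range i then π (P s) else q s
  have hq'1 : ∀ s, p s ∉ Set.range i → q' s = q s := fun s h => if_neg h
  have hq'2 : ∀ s m, p s = i m → q' s = m := fun s m h => by
    rw [← hπP s m h]
    exact if_pos ⟨m, h.symm⟩
  have hmixed : ∀ s t, p s ∉ Set.range i → p t ∈ Set.range i →
      |⟪q' s, q' t⟫ - ⟪p s, p t⟫| ≤ η := by
    rintro s t hs ⟨m, hm⟩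
    have h1 := hq2 s t
    rw [hπP t m hm.symm, ← i.inner_map_map (π (P s)), hP1 s hs] at h1
    have h2 : ⟪p s, i m⟫ = ⟪i (π (p s)), i m⟫ := by
      rw [← sub_eq_zero, ← inner_sub_left, hπ]
    rwa [hq'1 s hs, hq'2 t m hm.symm, ← hm, h2]
  refine ⟨q', fun s t => ?_, fun s => ?_, hq'2⟩
  · by_cases hs : p s ∈ Set.range i
    · by_cases ht : p t ∈ Set.range i
      · obtain ⟨m, hm⟩ := hs
        obtain ⟨m', hm'⟩ := ht
        rw [hq'2 s m hm.symm, hq'2 t m' hm'.symm, ← hm, ← hm', i.inner_map_map, sub_self, abs_zero]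
        exact hη.le
      · rw [real_inner_comm, real_inner_comm (p t)]
        exact hmixed t s ht hs
    · by_cases ht : p t ∈ Set.range i
      · exact hmixed s t hs ht
      · rw [hq'1 s hs, hq'1 t ht, ← hP1 s hs, ← hP1 t ht]
        exact hq1 s t
  · by_cases hs : p s ∈ Set.range i
    · obtain ⟨m, hm⟩ := hs
      rw [hq'2 s m hm.symm, ← hm, hi, sub_self, abs_zero]
      exact hη.le
    · rw [hq'1 s hs, ← hP1 s hs]
      exact hq3 s

end Extension

/-! ### Continuity of quantifier-free formulas -/

section Formulas

variable {α : Type}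

/-- The set of terms to which `d_N` is applied in a quantifier-free formula. -/
def QFFormula.dNTerms : QFFormula α → Set (LTerm α)
  | .inner _ _ => ∅
  | .dist _ _ => ∅
  | .dN t => {t}
  | .conn _ ψ => ⋃ j, (ψ j).dNTerms

lemma QFFormula.finite_dNTerms (ψ : QFFormula α) : ψ.dNTerms.Finite := by
  induction ψ with
  | inner s t => exact Set.finite_empty
  | dist s t => exact Set.finite_empty
  | dN t => exact Set.finite_singleton t
  | conn g ψ ih => exact Set.finite_iUnion ih

variable {M : Type u} [NormedAddCommGroup M] [InnerProductSpace ℝ M]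
  {H : Type v} [NormedAddCommGroup H] [InnerProductSpace ℝ H]
  {ι : Type*} {l : Filter ι}

lemma LTerm.tendsto_inner_realize {a : ι → α → M} {a₀ : α → H} {r : ι → M} {r₀ : H}
    (h : ∀ j, Tendsto (fun n => ⟪a n j, r n⟫) l (𝓝 ⟪a₀ j, r₀⟫)) (t : LTerm α) :
    Tendsto (fun n => ⟪t.realize (a n), r n⟫) l (𝓝 ⟪t.realize a₀, r₀⟫) := by
  induction t with
  | var j => exact h j
  | zero => simpa [LTerm.realize] using tendsto_const_nhds
  | add s t hs ht => simpa only [LTerm.realize, inner_add_left] using hs.add ht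
  | smul c t ht => simpa only [LTerm.realize, real_inner_smul_left] using ht.const_mul c

lemma LTerm.tendsto_inner_realize_realize {a : ι → α → M} {a₀ : α → H}
    (h : ∀ j j', Tendsto (fun n => ⟪a n j, a n j'⟫) l (𝓝 ⟪a₀ j, a₀ j'⟫)) (s t : LTerm α) :
    Tendsto (fun n => ⟪s.realize (a n), t.realize (a n)⟫) l
      (𝓝 ⟪s.realize a₀, t.realize a₀⟫) := by
  refine s.tendsto_inner_realize fun j => ?_
  simp only [real_inner_comm _ (a₀ j), fun n => real_inner_comm (t.realize (a n)) (a n j)]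
  exact t.tendsto_inner_realize fun j' => h j' j

lemma tendsto_norm_sub_of_tendsto_inner {x y : ι → M} {x₀ y₀ : H}
    (hxx : Tendsto (fun n => ⟪x n, x n⟫) l (𝓝 ⟪x₀, x₀⟫))
    (hxy : Tendsto (fun n => ⟪x n, y n⟫) l (𝓝 ⟪x₀, y₀⟫))
    (hyy : Tendsto (fun n => ⟪y n, y n⟫) l (𝓝 ⟪y₀, y₀⟫)) :
    Tendsto (fun n => ‖x n - y n‖) l (𝓝 ‖x₀ - y₀‖) := by
  have h : Tendsto (fun n => ‖x n - y n‖ ^ 2) l (𝓝 (‖x₀ - y₀‖ ^ 2)) := by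
    simp only [sq_norm_sub_eq_gram]
    exact (hxx.sub (hxy.const_mul 2)).add hyy
  simpa only [Real.sqrt_sq (norm_nonneg _)] using h.sqrt

/-- The value of a quantifier-free formula depends continuously on the inner products of the
variables and on the values of `d` at the finitely many terms that occur. -/
lemma QFFormula.tendsto_realize {d : M → ℝ} {dH : H → ℝ} {a : ι → α → M} {a₀ : α → H}
    (h : ∀ j j', Tendsto (fun n => ⟪a n j, a n j'⟫) l (𝓝 ⟪a₀ j, a₀ j'⟫)) (ψ : QFFormula α)
    (hd : ∀ t ∈ ψ.dNTerms, Tendsto (fun n => d (t.realize (a n))) l (𝓝 (dH (t.realize a₀)))) :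
    Tendsto (fun n => ψ.realize d (a n)) l (𝓝 (ψ.realize dH a₀)) := by
  induction ψ with
  | inner s t => exact LTerm.tendsto_inner_realize_realize h s t
  | dist s t =>
    exact tendsto_norm_sub_of_tendsto_inner (LTerm.tendsto_inner_realize_realize h s s)
      (LTerm.tendsto_inner_realize_realize h s t) (LTerm.tendsto_inner_realize_realize h t t)
  | dN t => exact hd t rfl
  | conn g ψ ih =>
    exact (g.continuous.tendsto _).comp
      (tendsto_pi_nhds.2 fun j => ih j fun t ht => hd t (Set.mem_iUnion_of_mem j ht))

lemma tendsto_inner_of_tendsto_norm_sub {x x' y : ι → M} {c b : ℝ}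
    (h : Tendsto (fun n => ⟪x n, y n⟫) l (𝓝 c)) (hx : Tendsto (fun n => ‖x n - x' n‖) l (𝓝 0))
    (hy : Tendsto (fun n => ‖y n‖) l (𝓝 b)) : Tendsto (fun n => ⟪x' n, y n⟫) l (𝓝 c) := by
  have h1 : Tendsto (fun n => ⟪x n - x' n, y n⟫) l (𝓝 0) :=
    squeeze_zero_norm (fun n => norm_inner_le_norm _ _) (by simpa using hx.mul hy)
  simpa [inner_sub_left] using h.sub h1

lemma exists_norm_le_norm_sub_le (x : M) {r : ℝ} (hr : 0 ≤ r) :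
    ∃ x', ‖x'‖ ≤ r ∧ ‖x - x'‖ ≤ max (‖x‖ - r) 0 := by
  rcases le_or_gt ‖x‖ r with h | h
  · exact ⟨x, h, by simp⟩
  · have hx : 0 < ‖x‖ := hr.trans_lt h
    refine ⟨(r / ‖x‖) • x, ?_, le_max_of_le_left ?_⟩
    · rw [norm_smul, Real.norm_of_nonneg (by positivity), div_mul_cancel₀ _ hx.ne']
    · have h1 : r / ‖x‖ ≤ 1 := div_le_one_of_le₀ h.le hx.le
      rw [show x - (r / ‖x‖) • x = (1 - r / ‖x‖) • x by rw [sub_smul, one_smul], norm_smul,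
        Real.norm_of_nonneg (sub_nonneg.2 h1), sub_mul, one_mul, div_mul_cancel₀ _ hx.ne']

end Formulas

/-! ### Existential closedness -/

/-- The imitations of all variables and of all terms inside `d_N`, with error `1 / (n + 1)`, form a
sequence along which inner products and values of `d` converge. The copies of the
variables are moved into the prescribed balls; the copy of a term stays close to the value of the
term at the copied variables because the inner products determine this distance. -/
theorem IsModelTN.isExistentiallyClosed {M : Type u} [NormedAddCommGroup M] [InnerProductSpace ℝ M]
    [CompleteSpace M] {d : M → ℝ} {F : LocusFormula → ℝ → ℝ} (hF : IsModulusChoice F)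
    (hM : IsModelTN F d) : IsExistentiallyClosed.{u, v} d := by
  intro H _ _ _ dH hdH i hi p l ψ m e a ha hψ τ hτ
  set a₀ : Fin p ⊕ Fin l → H := Sum.elim a fun s => i (e s) with ha₀
  let S : Set (LTerm (Fin p ⊕ Fin l)) := ψ.dNTerms ∪ Set.range LTerm.var
  have : Finite S := (ψ.finite_dNTerms.union (Set.finite_range _)).to_subtype
  choose q hq1 hq2 hq3 using fun n : ℕ => hM.exists_approx hF hdH hi
    (fun t : S => t.1.realize a₀) (Nat.one_div_pos_of_nat (α := ℝ) (n := n))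
  have hlim := tendsto_one_div_add_atTop_nhds_zero_nat (𝕜 := ℝ)
  have hqG : ∀ s t : S, Tendsto (fun n => ⟪q n s, q n t⟫) atTop
      (𝓝 ⟪s.1.realize a₀, t.1.realize a₀⟫) := fun s t =>
    tendsto_iff_norm_sub_tendsto_zero.2
      (squeeze_zero (fun n => norm_nonneg _) (fun n => hq1 n s t) hlim)
  have hqd : ∀ t : S, Tendsto (fun n => d (q n t)) atTop (𝓝 (dH (t.1.realize a₀))) := fun t =>
    tendsto_iff_norm_sub_tendsto_zero.2
      (squeeze_zero (fun n => norm_nonneg _) (fun n => hq2 n t) hlim)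
  have hqn : ∀ t : S, Tendsto (fun n => ‖q n t‖) atTop (𝓝 ‖t.1.realize a₀‖) := fun t => by
    simpa only [norm_eq_sqrt_real_inner] using (hqG t t).sqrt
  let x : Fin p ⊕ Fin l → S := fun j => ⟨.var j, .inr ⟨j, rfl⟩⟩
  choose b hb1 hb2 using fun n (s : Fin p) =>
    exists_norm_le_norm_sub_le (q n (x (.inl s))) (Nat.cast_nonneg (α := ℝ) (m s))
  let c : ℕ → Fin p ⊕ Fin l → M := fun n => Sum.elim (b n) e
  have hc : ∀ j, Tendsto (fun n => ‖q n (x j) - c n j‖) atTop (𝓝 0) := by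
    rintro (s | s)
    · have h1 : Tendsto (fun n => max (‖q n (x (.inl s))‖ - m s) 0) atTop
          (𝓝 (max (‖a s‖ - m s) 0)) := ((hqn (x (.inl s))).sub_const _).max tendsto_const_nhds
      rw [max_eq_right (sub_nonpos.2 (ha s))] at h1
      exact squeeze_zero (fun n => norm_nonneg _) (fun n => hb2 n s) h1
    · have h1 : ∀ n, q n (x (.inr s)) = e s := fun n => hq3 n (x (.inr s)) (e s) rfl
      simp [c, h1]
  have hcq : ∀ j (t : S), Tendsto (fun n => ⟪c n j, q n t⟫) atTop (𝓝 ⟪a₀ j, t.1.realize a₀⟫) :=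
    fun j t => tendsto_inner_of_tendsto_norm_sub (hqG (x j) t) (hc j) (hqn t)
  have hcn : ∀ j, Tendsto (fun n => ‖c n j‖) atTop (𝓝 ‖a₀ j‖) := by
    intro j
    have h1 : Tendsto (fun n => ‖c n j‖ - ‖q n (x j)‖) atTop (𝓝 0) :=
      squeeze_zero_norm (fun n => (abs_norm_sub_norm_le _ _).trans_eq (norm_sub_rev _ _)) (hc j)
    simpa [x, LTerm.realize] using h1.add (hqn (x j))
  have hcc : ∀ j j', Tendsto (fun n => ⟪c n j, c n j'⟫) atTop (𝓝 ⟪a₀ j, a₀ j'⟫) := by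
    intro j j'
    have h1 := hcq j (x j')
    simp only [fun n => real_inner_comm (q n (x j')) (c n j)] at h1 ⊢
    simp only [fun n => real_inner_comm (c n j') (c n j)]
    exact tendsto_inner_of_tendsto_norm_sub h1 (hc j') (hcn j)
  have hcd : ∀ t ∈ ψ.dNTerms,
      Tendsto (fun n => d (t.realize (c n))) atTop (𝓝 (dH (t.realize a₀))) := by
    intro t ht
    let t' : S := ⟨t, .inl ht⟩
    have h1 := tendsto_norm_sub_of_tendsto_inner (LTerm.tendsto_inner_realize_realize hcc t t)
      (t.tendsto_inner_realize fun j => hcq j t') (hqG t' t')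
    rw [sub_self, norm_zero] at h1
    have h2 : Tendsto (fun n => d (t.realize (c n)) - d (q n t')) atTop (𝓝 0) :=
      squeeze_zero_norm (fun n => hM.isModelT0.abs_sub_le _ _) h1
    simpa using h2.add (hqd t')
  have hlimψ := (ψ.tendsto_realize hcc hcd).abs
  rw [hψ, abs_zero] at hlimψ
  obtain ⟨n, hn⟩ := (hlimψ.eventually_lt_const hτ).exists
  exact ⟨b n, hb1 n, hn⟩

end RandomSubset

theorem mainTheorem2 {M : Type u} [NormedAddCommGroup M] [InnerProductSpace ℝ M]
    [CompleteSpace M] (d : M → ℝ) (F : RandomSubset.LocusFormula → ℝ → ℝ)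
    (hF : RandomSubset.IsModulusChoice F) (hM : RandomSubset.IsModelTN F d) :
    RandomSubset.IsExistentiallyClosed.{u, v} d :=
  hM.isExistentiallyClosed hF
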